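/- Let $\mathcal L$ be the category of bounded lattices and bounded lattice homomorphisms, and $\mathcal L^+$ the category of complete lattices and complete lattice homomorphisms. Let $2=\{0,1\}$ with $0<1$, regarded as a bounded lattice, as an ordered set, and as a discrete space. For a partial map $f$ into $2$, $f^{-1}(i)$ is the set of points at which $f$ is defined with value $i$; a composite of a partial map with a total map is defined wherever it makes sense. For $L\in\mathcal L$ let $\mathrm{SPH}(L)$ be the set of special partial homomorphisms, i.e. partial maps $f$ from $L$ to $2$ whose domain is a $0,1$-sublattice, which are bounded lattice homomorphisms on their domain, and for which $f^{-1}(1)$ is a filter and $f^{-1}(0)$ is an ideal of $L$. Put $(f,g)\in E$ iff $f(x)\le g(x)$ for all $x\in\mathrm{dom}(f)\cap\mathrm{dom}(g)$, and let $\mathcal T$ be the topology on $\mathrm{SPH}(L)$ in which the sets $\{f : f(a)=0\}$ and $\{f : f(a)=1\}$ $(a\in L)$ form a subbasis of closed sets. An $\mathcal L$-graph (with topology) is a structure isomorphic to $(\mathrm{SPH}(L),E)$ (respectively $(\mathrm{SPH}(L),E,\mathcal T)$) for some $L\in\mathcal L$. On an $\mathcal L$-graph $(X,E)$ let $f\le_1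 g$ iff there is no $h$ with $(g,h)\in E$ and $(f,h)\notin E$, and $f\le_2 g$ iff there is no $h$ with $(h,g)\in E$ and $(h,f)\notin E$ (on $\mathrm{SPH}(L)$ these mean $f^{-1}(1)\subseteq g^{-1}(1)$ and $f^{-1}(0)\subseteq g^{-1}(0)$). For $A\subseteq X$ let $\ell(A)=\{f : f\not\le_1 g \text{ for all } g\in A\}$ and $r(A)=\{f : f\not\le_2 g\text{ for all } g\in A\}$; $A$ is $\ell$-stable if $\ell r(A)=A$ and $r$-stable if $r\ell(A)=A$. An $\mathcal L$-graph morphism $\alpha:X\to Y$ is a map preserving $\le_1$ and $\le_2$ such that $\alpha^{-1}(r(A))=r(\alpha^{-1}(A))$ for every $\ell$-stable $A\subseteq Y$ and $\alpha^{-1}(\ell(A))=\ell(\alpha^{-1}(A))$ for every $r$-stable $A\subseteq Y$. Let $\mathcal Y$ be the category of $\mathcal L$-graphs and $\mathcal L$-graph morphisms, $\mathcal Y_{\mathcal T}$ the category of $\mathcal L$-graphs with topology and continuous $\mathcal L$-graph morphisms, and $\flat:\mathcal Y_{\mathcal T}\to\mathcal Y$ the functor forgetting the topology. For $Y\in\mathcal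 Y$ let $\mathrm{MPE}(Y)$ be the set of maximal partial $E$-preserving maps from $Y$ to $2$ (maximal under extension). For $Y\in\mathcal Y_{\mathcal T}$ let $\mathrm{MPM}(Y)$ be the set of those partial maps $Y\to 2$ that are maximal under extension among the partial maps with closed domain that are continuous and $E$-preserving on their domain. Both sets are ordered by $\varphi\le\psi\iff\varphi^{-1}(1)\subseteq\psi^{-1}(1)$. Then: (i) The assignments $\overline{\mathrm D}(L)=(\mathrm{SPH}(L),E,\mathcal T)$, $\overline{\mathrm D}(u)=-\circ u$ and $\overline{\mathrm G}(Y)=\mathrm{MPE}(Y)$, $\overline{\mathrm G}(\alpha)=-\circ\alpha$ are well-defined contravariant functors $\overline{\mathrm D}:\mathcal L\to\mathcal Y_{\mathcal T}$ and $\overline{\mathrm G}:\mathcal Y\to\mathcal L^+$. (ii) The assignment $\overline{\mathrm E}(Y)=\mathrm{MPM}(Y)$, $\overline{\mathrm E}(\alpha)=-\circ\alpha$ is a well-defined contravariant functor $\mathcal Y_{\mathcal T}\to\mathcal L$, and, viewing $\overline{\mathrm D}$ as a functor $\mathcal L\to\mathcal Y_{\mathcal T}^{\mathrm{op}}$ and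 $\overline{\mathrm E}$ as a functor $\mathcal Y_{\mathcal T}^{\mathrm{op}}\to\mathcal L$, $\overline{\mathrm E}$ is right adjoint to $\overline{\mathrm D}$ by an adjunction whose unit at each $L$ is the evaluation map $L\to\overline{\mathrm E}\,\overline{\mathrm D}(L)$, $a\mapsto \bar e_a$, where $\bar e_a(f)=f(a)$ if $a\in\mathrm{dom}(f)$ and $\bar e_a(f)$ is undefined otherwise; each of these maps is an isomorphism. (iii) The canonical extension functor on $\mathcal L$ factorises as $\overline{\mathrm G}\circ\flat\circ\overline{\mathrm D}$. Precisely: the maps $a\mapsto\bar e_a$ form a natural family of bounded lattice embeddings $L\to\overline{\mathrm G}\,\flat\,\overline{\mathrm D}(L)$, each of which is a canonical extension of $L$, that is, a completion which is dense (every element is a join of meets and a meet of joins of elements of $L$) and compact (if $\bigwedge A\le\bigvee B$ with $A,B\subseteq L$, then $\bigwedge A'\le\bigvee B'$ for some finite $A'\subseteq A$, $B'\subseteq B$); for every homomorphism $u$ the complete homomorphism $\overline{\mathrm G}\,\flat\,\overline{\mathrm D}(u)$ equals both canonical liftings of $u$, namely $x\mapsto\bigvee\{\bigwedge\{u(a):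 a\in L,\ p\le a\} : p\le x,\ p\text{ a meet of elements of }L\}$ and $x\mapsto\bigwedge\{\bigvee\{u(a): a\in L,\ a\le q\} : q\ge x,\ q\text{ a join of elements of }L\}$; and for every functor $\Delta:\mathcal L\to\mathcal L^+$ with a natural family of embeddings $\eta_L:L\to\Delta(L)$ that are canonical extensions there is a unique natural isomorphism $\overline{\mathrm G}\circ\flat\circ\overline{\mathrm D}\cong\Delta$ carrying $\bar e_a$ to $\eta_L(a)$ for all $L$ and all $a\in L$. -/

import Mathlib

open CategoryTheory Opposite

universe u

noncomputable section

namespace LatDual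

/-! ### Partial maps into the two-element set

The two-element lattice / ordered set / discrete space is `Bool`, with `false < true`. A partial map
is a `PFun`; `s ∈ φ x` says that `φ` is defined at `x` with value `s`. -/

/-- The set `φ⁻¹(1)`. -/
def oneSet {X : Type u} (φ : X →. Bool) : Set X := {x | true ∈ φ x}

/-- The set `φ⁻¹(0)`. -/
def zeroSet {X : Type u} (φ : X →. Bool) : Set X := {x | false ∈ φ x}

/-- `ψ` extends `φ`. -/
def Extends {X : Type u} (ψ φ : X →. Bool) : Prop := ∀ x, ∀ s ∈ φ x, s ∈ ψ x

/-- The composite `φ ∘ α`, defined at exactly those `x` for which `φ` is defined at `α x`. -/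
def pcomp {X Y : Type u} (φ : Y →. Bool) (α : X → Y) : X →. Bool := fun x => φ (α x)

open Classical in
/-- The partial map with value `1` on `A` and value `0` on `B \ A`, undefined elsewhere. -/
def pairMap {X : Type u} (A B : Set X) : X →. Bool :=
  fun x => ⟨x ∈ A ∨ x ∈ B, fun _ => decide (x ∈ A)⟩

theorem true_mem_pairMap {X : Type u} {A B : Set X} {x : X} : true ∈ pairMap A B x ↔ x ∈ A := by
  simp only [pairMap, Part.mem_mk_iff, decide_eq_true_eq]
  exact ⟨fun ⟨_, h⟩ => h, fun h => ⟨Or.inl h, h⟩⟩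

theorem false_mem_pairMap {X : Type u} {A B : Set X} {x : X} :
    false ∈ pairMap A B x ↔ x ∈ B ∧ x ∉ A := by
  simp only [pairMap, Part.mem_mk_iff, decide_eq_false_iff_not]
  exact ⟨fun ⟨h, h'⟩ => ⟨h.resolve_left h', h'⟩, fun ⟨h, h'⟩ => ⟨Or.inr h, h'⟩⟩

/-! ### Maximal partial `E`-preserving maps into the two-element ordered set -/

/-- The partial map `φ` preserves `E`. -/
def EPreserving {X : Type u} (E : X → X → Prop) (φ : X →. Bool) : Prop :=
  ∀ x y, E x y → ∀ s ∈ φ x, ∀ t ∈ φ y, s ≤ t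

/-- `φ` is a maximal partial `E`-preserving map (an MPE). -/
def IsMPE {X : Type u} (E : X → X → Prop) (φ : X →. Bool) : Prop :=
  EPreserving E φ ∧ ∀ ψ, EPreserving E ψ → Extends ψ φ → ψ = φ

/-- The set of MPE's of the graph `(X, E)`. -/
def MPE {X : Type u} (E : X → X → Prop) : Type u := {φ : X →. Bool // IsMPE E φ}

/-- An MPE as an element of `MPE E`. -/
def MPE.mk {X : Type u} {E : X → X → Prop} (φ : X →. Bool) (h : IsMPE E φ) : MPE E := ⟨φ, h⟩

/-- `φ` is a partial morphism of graphs with topology into the discrete two-element ordered set: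
its domain is closed, and it is continuous and `E`-preserving on its domain. -/
def IsPartialMorphism {X : Type u} [TopologicalSpace X] (E : X → X → Prop) (φ : X →. Bool) : Prop :=
  IsClosed φ.Dom ∧ Continuous φ.asSubtype ∧ EPreserving E φ

/-- `φ` is a maximal partial morphism (an MPM). -/
def IsMPM {X : Type u} [TopologicalSpace X] (E : X → X → Prop) (φ : X →. Bool) : Prop :=
  IsPartialMorphism E φ ∧ ∀ ψ, IsPartialMorphism E ψ → Extends ψ φ → ψ = φ

/-- The set of MPM's of the graph with topology `(X, E, 𝒯)`. -/
def MPM {X : Type u} [TopologicalSpace X] (E : X → X → Prop) : Type u :=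
  {φ : X →. Bool // IsMPM E φ}

/-- An MPM as an element of `MPM E`. -/
def MPM.mk {X : Type u} [TopologicalSpace X] {E : X → X → Prop} (φ : X →. Bool) (h : IsMPM E φ) :
    MPM E := ⟨φ, h⟩

theorem EPreserving.pairMap {X : Type u} {E : X → X → Prop} {A B : Set X}
    (h : ∀ x ∈ A, ∀ y ∈ B, ¬ E x y) : EPreserving E (pairMap A B) := by
  intro x y hxy s hs t ht
  cases s
  · exact Bool.false_le t
  · cases t
    · exact absurd hxy (h x (true_mem_pairMap.1 hs) y (false_mem_pairMap.1 ht).1)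
    · exact le_rfl

theorem EPreserving.not_rel {X : Type u} {E : X → X → Prop} {φ : X →. Bool} (h : EPreserving E φ)
    {x y : X} (hx : true ∈ φ x) (hy : false ∈ φ y) : ¬ E x y :=
  fun hxy => absurd (h x y hxy true hx false hy) (by decide)

theorem extends_pairMap {X : Type u} {φ : X →. Bool} {A B : Set X} (hA : A = oneSet φ)
    (hB : zeroSet φ ⊆ B) : Extends (pairMap A B) φ := by
  subst hA
  intro x s hs
  cases s
  · exact false_mem_pairMap.2 ⟨hB hs, fun h => absurd (Part.mem_unique h hs) (by decide)⟩
  · exact true_mem_pairMap.2 hs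

/-- MPE's are ordered by inclusion of the sets `φ⁻¹(1)`. -/
instance {X : Type u} (E : X → X → Prop) : PartialOrder (MPE E) where
  le φ ψ := oneSet φ.1 ⊆ oneSet ψ.1
  le_refl _ := subset_rfl
  le_trans _ _ _ h h' := h.trans h'
  le_antisymm φ ψ h h' := by
    have h1 : oneSet φ.1 = oneSet ψ.1 := h.antisymm h'
    have hE : EPreserving E (pairMap (oneSet φ.1) (zeroSet φ.1 ∪ zeroSet ψ.1)) := by
      refine EPreserving.pairMap fun x hx y hy => hy.elim ?_ ?_
      · exact fun hy => φ.2.1.not_rel hx hy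
      · exact fun hy => ψ.2.1.not_rel (h hx) hy
    exact Subtype.ext ((φ.2.2 _ hE (extends_pairMap rfl Set.subset_union_left)).symm.trans
      (ψ.2.2 _ hE (extends_pairMap h1 Set.subset_union_right)))

theorem isClosed_of_isPartialMorphism {X : Type u} [TopologicalSpace X] {E : X → X → Prop}
    {φ : X →. Bool} (h : IsPartialMorphism E φ) (s : Bool) : IsClosed {x | s ∈ φ x} := by
  have h1 : IsClosed (φ.asSubtype ⁻¹' {s}) := (isClosed_discrete {s}).preimage h.2.1
  have h2 := h.1.isClosedEmbedding_subtypeVal.isClosedMap _ h1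
  convert h2 using 1
  ext x
  constructor
  · intro hx
    exact ⟨⟨x, (PFun.mem_dom _ _).2 ⟨s, hx⟩⟩, PFun.asSubtype_eq_of_mem hx _, rfl⟩
  · rintro ⟨⟨y, hy⟩, hs, rfl⟩
    have : φ.asSubtype ⟨y, hy⟩ = s := hs
    subst this
    exact Part.get_mem _

theorem isPartialMorphism_of_isClosed {X : Type u} [TopologicalSpace X] {E : X → X → Prop}
    {φ : X →. Bool} (h1 : IsClosed (oneSet φ)) (h0 : IsClosed (zeroSet φ)) (hE : EPreserving E φ) :
    IsPartialMorphism E φ := by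
  refine ⟨?_, ?_, hE⟩
  · convert h1.union h0 using 1
    ext x
    simp [oneSet, zeroSet, or_comm]
  · have key : ∀ s : Bool, IsClosed (φ.asSubtype ⁻¹' {s}) := by
      intro s
      have : φ.asSubtype ⁻¹' {s} = Subtype.val ⁻¹' {x | s ∈ φ x} := by
        ext ⟨x, hx⟩
        constructor
        · intro hs
          have : φ.asSubtype ⟨x, hx⟩ = s := hs
          subst this
          exact Part.get_mem _
        · exact fun hs => PFun.asSubtype_eq_of_mem hs _
      rw [this]
      cases s
      · exact h0.preimage continuous_subtype_val
      · exact h1.preimage continuous_subtype_val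
    refine continuous_iff_isClosed.2 fun S _ => ?_
    rw [← Set.biUnion_of_singleton S, Set.preimage_iUnion₂]
    exact Set.Finite.isClosed_biUnion (Set.toFinite S) fun s _ => key s

/-- MPM's are ordered by inclusion of the sets `φ⁻¹(1)`. -/
instance {X : Type u} [TopologicalSpace X] (E : X → X → Prop) : PartialOrder (MPM E) where
  le φ ψ := oneSet φ.1 ⊆ oneSet ψ.1
  le_refl _ := subset_rfl
  le_trans _ _ _ h h' := h.trans h'
  le_antisymm φ ψ h h' := by
    have h1 : oneSet φ.1 = oneSet ψ.1 := h.antisymm h'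
    have hE : IsPartialMorphism E (pairMap (oneSet φ.1) (zeroSet φ.1 ∪ zeroSet ψ.1)) := by
      refine isPartialMorphism_of_isClosed ?_ ?_ (EPreserving.pairMap fun x hx y hy => hy.elim ?_ ?_)
      · convert isClosed_of_isPartialMorphism φ.2.1 true using 1
        ext x
        exact true_mem_pairMap
      · convert (isClosed_of_isPartialMorphism φ.2.1 false).union
          (isClosed_of_isPartialMorphism ψ.2.1 false) using 1
        ext x
        refine false_mem_pairMap.trans ⟨And.left, fun hx => ⟨hx, fun hx' => hx.elim ?_ ?_⟩⟩
        · exact fun hy => absurd (Part.mem_unique hx' hy) (by decide)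
        · exact fun hy => absurd (Part.mem_unique (h hx') hy) (by decide)
      · exact fun hy => φ.2.1.2.2.not_rel hx hy
      · exact fun hy => ψ.2.1.2.2.not_rel (h hx) hy
    exact Subtype.ext ((φ.2.2 _ hE (extends_pairMap rfl Set.subset_union_left)).symm.trans
      (ψ.2.2 _ hE (extends_pairMap h1 Set.subset_union_right)))

/-! ### The dual space of special partial homomorphisms -/

/-- `f` is a partial homomorphism from `L` into the two-element bounded lattice: its domain is a
`0,1`-sublattice of `L` and it is a bounded lattice homomorphism on its domain. -/
structure IsPartialHom {L : Type u} [Lattice L] [BoundedOrder L] (f : L →. Bool) : Prop where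
  map_bot : ⊥ ∈ f ⊥
  map_top : ⊤ ∈ f ⊤
  map_sup : ∀ a b, ∀ s ∈ f a, ∀ t ∈ f b, s ⊔ t ∈ f (a ⊔ b)
  map_inf : ∀ a b, ∀ s ∈ f a, ∀ t ∈ f b, s ⊓ t ∈ f (a ⊓ b)

/-- `f` is a special partial homomorphism (an SPH): a partial homomorphism for which
`(f⁻¹(1), f⁻¹(0))` is a filter-ideal pair. -/
structure IsSPH {L : Type u} [Lattice L] [BoundedOrder L] (f : L →. Bool) : Prop
    extends IsPartialHom f where
  isPFilter : Order.IsPFilter (oneSet f)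
  isIdeal : Order.IsIdeal (zeroSet f)

/-- The set of SPH's from `L` into the two-element bounded lattice. -/
def SPH (L : BddLat.{u}) : Type u := {f : L →. Bool // IsSPH f}

/-- An SPH as an element of `SPH L`. -/
def SPH.mk {L : BddLat.{u}} (f : L →. Bool) (h : IsSPH f) : SPH L := ⟨f, h⟩

/-- The relation `E` on SPH's: `f(x) ≤ g(x)` for all `x ∈ dom f ∩ dom g`. -/
def SPH.E {L : BddLat.{u}} (f g : SPH L) : Prop := ∀ x, ∀ s ∈ f.1 x, ∀ t ∈ g.1 x, s ≤ t

/-- The topology on SPH's: the sets `V_a = {f | f(a) = 0}` and `W_a = {f | f(a) = 1}` form a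
subbasis of closed sets. -/
instance (L : BddLat.{u}) : TopologicalSpace (SPH L) :=
  TopologicalSpace.generateFrom {U | ∃ (a : L) (s : Bool), U = {f : SPH L | s ∈ f.1 a}ᶜ}

/-- The evaluation map `ē_a`, `f ↦ f(a)`, defined at those `f` with `a ∈ dom f`. -/
def evalMap {L : BddLat.{u}} (a : L) : SPH L →. Bool := fun f => f.1 a

/-! ### `𝓛`-graphs and their morphisms

On an `𝓛`-graph the two quasi-orders are recovered from `E`; see `SPH.le₁_iff`, `SPH.le₂_iff`. -/

section Graph

variable {X Y : Type u}

/-- The quasi-order `≤₁` of a graph. -/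
def le₁ (E : X → X → Prop) (f g : X) : Prop := ¬ ∃ h, E g h ∧ ¬ E f h

/-- The quasi-order `≤₂` of a graph. -/
def le₂ (E : X → X → Prop) (f g : X) : Prop := ¬ ∃ h, E h g ∧ ¬ E h f

/-- The map `ℓ` on subsets. -/
def ellMap (E : X → X → Prop) (A : Set X) : Set X := {f | ∀ g ∈ A, ¬ le₁ E f g}

/-- The map `r` on subsets. -/
def rMap (E : X → X → Prop) (A : Set X) : Set X := {f | ∀ g ∈ A, ¬ le₂ E f g}

/-- `A` is `ℓ`-stable. -/
def EllStable (E : X → X → Prop) (A : Set X) : Prop := ellMap E (rMap E A) = A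

/-- `A` is `r`-stable. -/
def RStable (E : X → X → Prop) (A : Set X) : Prop := rMap E (ellMap E A) = A

/-- `α` is an `𝓛`-graph morphism from `(X, EX)` to `(Y, EY)`. -/
structure IsLGraphMorphism (EX : X → X → Prop) (EY : Y → Y → Prop) (α : X → Y) : Prop where
  map_le₁ : ∀ f g, le₁ EX f g → le₁ EY (α f) (α g)
  map_le₂ : ∀ f g, le₂ EX f g → le₂ EY (α f) (α g)
  preimage_rMap : ∀ A, EllStable EY A → α ⁻¹' (rMap EY A) = rMap EX (α ⁻¹' A)
  preimage_ellMap : ∀ A, RStable EY A → α ⁻¹' (ellMap EY A) = ellMap EX (α ⁻¹' A)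

theorem IsLGraphMorphism.id (EX : X → X → Prop) : IsLGraphMorphism EX EX id :=
  ⟨fun _ _ h => h, fun _ _ h => h, fun _ _ => rfl, fun _ _ => rfl⟩

theorem IsLGraphMorphism.comp {Z : Type u} {EX : X → X → Prop} {EY : Y → Y → Prop}
    {EZ : Z → Z → Prop} {β : Y → Z} {α : X → Y} (hβ : IsLGraphMorphism EY EZ β)
    (hα : IsLGraphMorphism EX EY α) : IsLGraphMorphism EX EZ (β ∘ α) where
  map_le₁ f g h := hβ.map_le₁ _ _ (hα.map_le₁ _ _ h)
  map_le₂ f g h := hβ.map_le₂ _ _ (hα.map_le₂ _ _ h)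
  preimage_rMap A hA := by
    have hr : RStable EZ (rMap EZ A) := congrArg (rMap EZ) hA
    have hs : EllStable EY (β ⁻¹' A) := by
      unfold EllStable at hA ⊢
      rw [← hβ.preimage_rMap A hA, ← hβ.preimage_ellMap _ hr, hA]
    rw [Set.preimage_comp, hβ.preimage_rMap A hA, hα.preimage_rMap _ hs, Set.preimage_comp]
  preimage_ellMap A hA := by
    have hl : EllStable EZ (ellMap EZ A) := congrArg (ellMap EZ) hA
    have hs : RStable EY (β ⁻¹' A) := by
      unfold RStable at hA ⊢
      rw [← hβ.preimage_ellMap A hA, ← hβ.preimage_rMap _ hl, hA]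
    rw [Set.preimage_comp, hβ.preimage_ellMap A hA, hα.preimage_ellMap _ hs, Set.preimage_comp]

end Graph

/-- The special partial homomorphism given by a disjoint filter-ideal pair. -/
def SPH.ofPair {L : BddLat.{u}} (F I : Set L) (hF : Order.IsPFilter F) (hI : Order.IsIdeal I)
    (hFI : ∀ a ∈ F, a ∉ I) : SPH L := by
  have h1 : ∀ a, true ∈ LatDual.pairMap F I a ↔ a ∈ F := fun a => true_mem_pairMap
  have h0 : ∀ a, false ∈ LatDual.pairMap F I a ↔ a ∈ I := fun a =>
    false_mem_pairMap.trans ⟨And.left, fun h => ⟨h, fun h' => hFI a h' h⟩⟩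
  have up : ∀ {a b : L}, a ≤ b → a ∈ F → b ∈ F := fun {a b} hab ha => (hF.toPFilter).mem_of_le hab ha
  have dn : ∀ {a b : L}, a ≤ b → b ∈ I → a ∈ I := fun {a b} hab hb => hI.IsLowerSet hab hb
  have inf : ∀ {a b : L}, a ∈ F → b ∈ F → a ⊓ b ∈ F := fun {a b} ha hb =>
    Order.PFilter.inf_mem (F := hF.toPFilter) ha hb
  have sup : ∀ {a b : L}, a ∈ I → b ∈ I → a ⊔ b ∈ I := fun {a b} ha hb =>
    Order.Ideal.sup_mem (s := hI.toIdeal) ha hb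
  refine ⟨LatDual.pairMap F I, ⟨⟨?_, ?_, ?_, ?_⟩, ?_, ?_⟩⟩
  · obtain ⟨a, ha⟩ := hI.Nonempty
    exact (h0 _).2 (dn bot_le ha)
  · exact (h1 _).2 (Order.PFilter.top_mem (F := hF.toPFilter))
  · rintro a b (_ | _) hs (_ | _) ht
    · exact (h0 _).2 (sup ((h0 _).1 hs) ((h0 _).1 ht))
    · exact (h1 _).2 (up le_sup_right ((h1 _).1 ht))
    · exact (h1 _).2 (up le_sup_left ((h1 _).1 hs))
    · exact (h1 _).2 (up le_sup_left ((h1 _).1 hs))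
  · rintro a b (_ | _) hs (_ | _) ht
    · exact (h0 _).2 (dn inf_le_left ((h0 _).1 hs))
    · exact (h0 _).2 (dn inf_le_left ((h0 _).1 hs))
    · exact (h0 _).2 (dn inf_le_right ((h0 _).1 ht))
    · exact (h1 _).2 (inf ((h1 _).1 hs) ((h1 _).1 ht))
  · rwa [show oneSet (LatDual.pairMap F I) = F from Set.ext h1]
  · rwa [show zeroSet (LatDual.pairMap F I) = I from Set.ext h0]

theorem SPH.rel_iff {L : BddLat.{u}} {f g : SPH L} :
    SPH.E f g ↔ ∀ a ∈ oneSet f.1, a ∉ zeroSet g.1 := by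
  refine ⟨fun h a ha hb => absurd (h a true ha false hb) (by decide), fun h a s hs t ht => ?_⟩
  cases s
  · exact Bool.false_le t
  · cases t
    · exact absurd ht (h a hs)
    · exact le_rfl

/-- On SPH's, `f ≤₁ g` means `f⁻¹(1) ⊆ g⁻¹(1)`. -/
theorem SPH.le₁_iff {L : BddLat.{u}} {f g : SPH L} :
    le₁ SPH.E f g ↔ oneSet f.1 ⊆ oneSet g.1 := by
  constructor
  · intro h a ha
    by_contra hga
    have hd : ∀ b ∈ oneSet g.1, b ∉ Set.Iic a := fun b hb hba =>
      hga (g.2.isPFilter.toPFilter.mem_of_le hba hb)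
    refine h ⟨SPH.ofPair (oneSet g.1) (Set.Iic a) g.2.isPFilter (Order.Ideal.principal a).isIdeal hd,
      SPH.rel_iff.2 fun b hb hb' => hd b hb (false_mem_pairMap.1 hb').1,
      fun hE => SPH.rel_iff.1 hE a ha (false_mem_pairMap.2 ⟨le_rfl, hga⟩)⟩
  · rintro h ⟨k, h1, h2⟩
    exact h2 (SPH.rel_iff.2 fun a ha => SPH.rel_iff.1 h1 a (h ha))

/-- On SPH's, `f ≤₂ g` means `f⁻¹(0) ⊆ g⁻¹(0)`. -/
theorem SPH.le₂_iff {L : BddLat.{u}} {f g : SPH L} :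
    le₂ SPH.E f g ↔ zeroSet f.1 ⊆ zeroSet g.1 := by
  constructor
  · intro h a ha
    by_contra hga
    have hd : ∀ b ∈ Set.Ici a, b ∉ zeroSet g.1 := fun b hab hb => hga (g.2.isIdeal.IsLowerSet hab hb)
    refine h ⟨SPH.ofPair (Set.Ici a) (zeroSet g.1) (Order.PFilter.principal a).isPFilter
      g.2.isIdeal hd, SPH.rel_iff.2 fun b hb hb' => hd b (true_mem_pairMap.1 hb) hb',
      fun hE => SPH.rel_iff.1 hE a (true_mem_pairMap.2 le_rfl) ha⟩
  · rintro h ⟨k, h1, h2⟩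
    exact h2 (SPH.rel_iff.2 fun a ha ha' => SPH.rel_iff.1 h1 a ha (h ha'))

/-! ### The categories `𝓨` and `𝓨_𝒯` -/

/-- An `𝓛`-graph: a graph that is (isomorphic to) the graph of SPH's of some bounded lattice. -/
structure LGraph where
  carrier : Type u
  E : carrier → carrier → Prop
  isLGraph : ∃ L : BddLat.{u}, Nonempty (E ≃r (SPH.E : SPH L → SPH L → Prop))

/-- An `𝓛`-graph with topology: a graph with topology that is (isomorphic to) the dual space of
SPH's of some bounded lattice. -/
structure TopLGraph where
  carrier : Type u
  [top : TopologicalSpace carrier]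
  E : carrier → carrier → Prop
  isLGraph : ∃ (L : BddLat.{u}) (e : carrier ≃ₜ SPH L), ∀ x y, SPH.E (e x) (e y) ↔ E x y

attribute [instance] TopLGraph.top

/-- The category `𝓨` of `𝓛`-graphs and `𝓛`-graph morphisms. -/
instance : Category LGraph.{u} where
  Hom X Y := {α : X.carrier → Y.carrier // IsLGraphMorphism X.E Y.E α}
  id X := ⟨id, IsLGraphMorphism.id X.E⟩
  comp α β := ⟨β.1 ∘ α.1, β.2.comp α.2⟩

/-- The category `𝓨_𝒯` of `𝓛`-graphs with topology and continuous `𝓛`-graph morphisms. -/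
instance : Category TopLGraph.{u} where
  Hom X Y := {α : X.carrier → Y.carrier // IsLGraphMorphism X.E Y.E α ∧ Continuous α}
  id X := ⟨id, IsLGraphMorphism.id X.E, continuous_id⟩
  comp α β := ⟨β.1 ∘ α.1, β.2.1.comp α.2.1, β.2.2.comp α.2.2⟩

/-- The functor `♭ : 𝓨_𝒯 ⥤ 𝓨` forgetting the topology. -/
def flat : TopLGraph.{u} ⥤ LGraph.{u} where
  obj X := ⟨X.carrier, X.E, let ⟨L, e, he⟩ := X.isLGraph; ⟨L, ⟨e.toEquiv, he _ _⟩⟩⟩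
  map α := ⟨α.1, α.2.1⟩

/-! ### The functor `D̄`

The contravariant functors are packaged from their object maps, the action on morphisms by
composition, and a proof that this action is well defined. -/

/-- The dual space `D̄(L)`. -/
def dualSpace (L : BddLat.{u}) : TopLGraph.{u} where
  carrier := SPH L
  E := SPH.E
  isLGraph := ⟨L, Homeomorph.refl _, fun _ _ => Iff.rfl⟩

/-- `D̄` is well defined: for `u : L → K`, composition with `u` sends SPH's to SPH's and is a
continuous `𝓛`-graph morphism `D̄(K) → D̄(L)`. -/
structure DbarWellDefined : Prop where
  isSPH : ∀ {L K : BddLat.{u}} (u : L ⟶ K) (f : SPH K), IsSPH (pcomp f.1 (fun a : L => u a))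
  isMorphism : ∀ {L K : BddLat.{u}} (u : L ⟶ K),
    IsLGraphMorphism (SPH.E (L := K)) (SPH.E (L := L))
      (fun f : SPH K => SPH.mk (pcomp f.1 (fun a : L => u a)) (isSPH u f))
  continuous : ∀ {L K : BddLat.{u}} (u : L ⟶ K),
    Continuous (fun f : SPH K => SPH.mk (pcomp f.1 (fun a : L => u a)) (isSPH u f))

/-- The functor `D̄`: `L ↦ SPH(L, 2)`, `u ↦ - ∘ u`. -/
def Dbar (h : DbarWellDefined.{u}) : BddLat.{u} ⥤ TopLGraph.{u}ᵒᵖ where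
  obj L := op (dualSpace L)
  map {L K} u := Quiver.Hom.op (X := dualSpace K) (Y := dualSpace L)
    ⟨fun f => SPH.mk (pcomp f.1 (fun a : L => u a)) (h.isSPH u f), h.isMorphism u, h.continuous u⟩
  map_id _ := rfl
  map_comp _ _ := rfl

/-! ### The functor `Ḡ` -/

/-- `Ḡ` is well defined: the MPE's of an `𝓛`-graph form a complete lattice, composition with an
`𝓛`-graph morphism `α : X → Y` sends MPE's of `Y` to MPE's of `X`, and it preserves arbitrary joins
and meets. -/
structure GbarWellDefined : Prop where
  exists_isLUB : ∀ (X : LGraph.{u}) (S : Set (MPE X.E)), ∃ φ, IsLUB S φ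
  exists_isGLB : ∀ (X : LGraph.{u}) (S : Set (MPE X.E)), ∃ φ, IsGLB S φ
  isMPE : ∀ {X Y : LGraph.{u}} (α : X ⟶ Y) (φ : MPE Y.E), IsMPE X.E (pcomp φ.1 α.1)
  isLUB : ∀ {X Y : LGraph.{u}} (α : X ⟶ Y) (S : Set (MPE Y.E)) (φ : MPE Y.E), IsLUB S φ →
    IsLUB ((fun ψ : MPE Y.E => MPE.mk (pcomp ψ.1 α.1) (isMPE α ψ)) '' S)
      (MPE.mk (pcomp φ.1 α.1) (isMPE α φ))
  isGLB : ∀ {X Y : LGraph.{u}} (α : X ⟶ Y) (S : Set (MPE Y.E)) (φ : MPE Y.E), IsGLB S φ →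
    IsGLB ((fun ψ : MPE Y.E => MPE.mk (pcomp ψ.1 α.1) (isMPE α ψ)) '' S)
      (MPE.mk (pcomp φ.1 α.1) (isMPE α φ))

/-- The complete lattice of MPE's (with the order defined above). -/
abbrev GbarWellDefined.completeLattice (h : GbarWellDefined.{u}) (X : LGraph.{u}) :
    CompleteLattice (MPE X.E) :=
  letI : SupSet (MPE X.E) := ⟨fun S => (h.exists_isLUB X S).choose⟩
  completeLatticeOfSup (MPE X.E) fun S => (h.exists_isLUB X S).choose_spec

/-- The object `Ḡ(X)`. -/
def GbarObj (h : GbarWellDefined.{u}) (X : LGraph.{u}) : CompleteLat.{u} :=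
  letI := h.completeLattice X
  CompleteLat.of (MPE X.E)

/-- The functor `Ḡ`: `X ↦ MPE(X, 2)`, `α ↦ - ∘ α`. -/
def Gbar (h : GbarWellDefined.{u}) : LGraph.{u}ᵒᵖ ⥤ CompleteLat.{u} where
  obj X := GbarObj h X.unop
  map {Y X} α :=
    letI := h.completeLattice X.unop
    letI := h.completeLattice Y.unop
    ConcreteCategory.ofHom (C := CompleteLat.{u}) (X := GbarObj h Y.unop) (Y := GbarObj h X.unop)
      { toFun := fun φ : MPE Y.unop.E =>
          MPE.mk (pcomp φ.1 α.unop.1) (h.isMPE α.unop φ)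
        map_sInf' := fun S => (h.isGLB α.unop S _ (isGLB_sInf S)).unique (isGLB_sInf _)
        map_sSup' := fun S => (h.isLUB α.unop S _ (isLUB_sSup S)).unique (isLUB_sSup _) }
  map_id _ := rfl
  map_comp _ _ := rfl

/-! ### The functor `Ē` -/

/-- `Ē` is well defined: the MPM's of an `𝓛`-graph with topology form a bounded lattice, composition
with a continuous `𝓛`-graph morphism `α : X → Y` sends MPM's of `Y` to MPM's of `X`, and it is a
bounded lattice homomorphism. -/
structure EbarWellDefined : Prop where
  exists_isLUB : ∀ (X : TopLGraph.{u}) (φ ψ : MPM X.E), ∃ χ, IsLUB {φ, ψ} χ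
  exists_isGLB : ∀ (X : TopLGraph.{u}) (φ ψ : MPM X.E), ∃ χ, IsGLB {φ, ψ} χ
  exists_isTop : ∀ X : TopLGraph.{u}, ∃ φ : MPM X.E, IsTop φ
  exists_isBot : ∀ X : TopLGraph.{u}, ∃ φ : MPM X.E, IsBot φ
  isMPM : ∀ {X Y : TopLGraph.{u}} (α : X ⟶ Y) (φ : MPM Y.E), IsMPM X.E (pcomp φ.1 α.1)
  isLUB : ∀ {X Y : TopLGraph.{u}} (α : X ⟶ Y) (φ ψ χ : MPM Y.E), IsLUB {φ, ψ} χ →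
    IsLUB {MPM.mk (pcomp φ.1 α.1) (isMPM α φ), MPM.mk (pcomp ψ.1 α.1) (isMPM α ψ)}
      (MPM.mk (pcomp χ.1 α.1) (isMPM α χ))
  isGLB : ∀ {X Y : TopLGraph.{u}} (α : X ⟶ Y) (φ ψ χ : MPM Y.E), IsGLB {φ, ψ} χ →
    IsGLB {MPM.mk (pcomp φ.1 α.1) (isMPM α φ), MPM.mk (pcomp ψ.1 α.1) (isMPM α ψ)}
      (MPM.mk (pcomp χ.1 α.1) (isMPM α χ))
  isTop : ∀ {X Y : TopLGraph.{u}} (α : X ⟶ Y) (φ : MPM Y.E), IsTop φ →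
    IsTop (MPM.mk (pcomp φ.1 α.1) (isMPM α φ))
  isBot : ∀ {X Y : TopLGraph.{u}} (α : X ⟶ Y) (φ : MPM Y.E), IsBot φ →
    IsBot (MPM.mk (pcomp φ.1 α.1) (isMPM α φ))

/-- The lattice of MPM's (with the order defined above). -/
abbrev EbarWellDefined.lattice (h : EbarWellDefined.{u}) (X : TopLGraph.{u}) :
    Lattice (MPM X.E) where
  sup φ ψ := (h.exists_isLUB X φ ψ).choose
  inf φ ψ := (h.exists_isGLB X φ ψ).choose
  le_sup_left φ ψ := (h.exists_isLUB X φ ψ).choose_spec.1 (Or.inl rfl)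
  le_sup_right φ ψ := (h.exists_isLUB X φ ψ).choose_spec.1 (Or.inr rfl)
  sup_le φ ψ _ h1 h2 := (h.exists_isLUB X φ ψ).choose_spec.2
    (by rintro _ (rfl | rfl); exacts [h1, h2])
  inf_le_left φ ψ := (h.exists_isGLB X φ ψ).choose_spec.1 (Or.inl rfl)
  inf_le_right φ ψ := (h.exists_isGLB X φ ψ).choose_spec.1 (Or.inr rfl)
  le_inf _ φ ψ h1 h2 := (h.exists_isGLB X φ ψ).choose_spec.2
    (by rintro _ (rfl | rfl); exacts [h1, h2])

/-- The bounds of the lattice of MPM's. -/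
abbrev EbarWellDefined.boundedOrder (h : EbarWellDefined.{u}) (X : TopLGraph.{u}) :
    BoundedOrder (MPM X.E) where
  top := (h.exists_isTop X).choose
  bot := (h.exists_isBot X).choose
  le_top := (h.exists_isTop X).choose_spec
  bot_le := (h.exists_isBot X).choose_spec

/-- The object `Ē(X)`. -/
def EbarObj (h : EbarWellDefined.{u}) (X : TopLGraph.{u}) : BddLat.{u} :=
  letI := h.lattice X
  letI : BoundedOrder (MPM X.E) := h.boundedOrder X
  BddLat.of (MPM X.E)

/-- The functor `Ē`: `X ↦ MPM(X, 2)`, `α ↦ - ∘ α`. -/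
def Ebar (h : EbarWellDefined.{u}) : TopLGraph.{u}ᵒᵖ ⥤ BddLat.{u} where
  obj X := EbarObj h X.unop
  map {Y X} α :=
    letI := h.lattice X.unop
    letI := h.lattice Y.unop
    letI : BoundedOrder (MPM X.unop.E) := h.boundedOrder X.unop
    letI : BoundedOrder (MPM Y.unop.E) := h.boundedOrder Y.unop
    ConcreteCategory.ofHom (C := BddLat.{u}) (X := EbarObj h Y.unop) (Y := EbarObj h X.unop)
      { toFun := fun φ : MPM Y.unop.E =>
          MPM.mk (pcomp φ.1 α.unop.1) (h.isMPM α.unop φ)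
        map_sup' := fun φ ψ => (h.isLUB α.unop φ ψ _ isLUB_pair).unique isLUB_pair
        map_inf' := fun φ ψ => (h.isGLB α.unop φ ψ _ isGLB_pair).unique isGLB_pair
        map_top' := (h.isTop α.unop _ isTop_top).eq_top
        map_bot' := (h.isBot α.unop _ isBot_bot).eq_bot }
  map_id _ := rfl
  map_comp _ _ := rfl

/-! ### Canonical extensions -/

section CanonicalExtension

variable {L K C D : Type u} [Lattice L] [BoundedOrder L] [Lattice K] [BoundedOrder K]
  [CompleteLattice C] [CompleteLattice D]

/-- `p` is a filter element of the completion `(e, C)`: a meet of elements of `e(L)`. -/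
def IsFilterElement (e : L → C) (p : C) : Prop := ∃ A : Set L, p = sInf (e '' A)

/-- `q` is an ideal element of the completion `(e, C)`: a join of elements of `e(L)`. -/
def IsIdealElement (e : L → C) (q : C) : Prop := ∃ A : Set L, q = sSup (e '' A)

/-- `(e, C)` is a canonical extension of `L`: a dense and compact completion. -/
structure IsCanonicalExtension (e : BoundedLatticeHom L C) : Prop where
  injective : Function.Injective e
  exists_sSup : ∀ x : C, ∃ S : Set C, (∀ p ∈ S, IsFilterElement e p) ∧ x = sSup S
  exists_sInf : ∀ x : C, ∃ S : Set C, (∀ q ∈ S, IsIdealElement e q) ∧ x = sInf S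
  compact : ∀ A B : Set L, sInf (e '' A) ≤ sSup (e '' B) →
    ∃ A' ⊆ A, ∃ B' ⊆ B, A'.Finite ∧ B'.Finite ∧ sInf (e '' A') ≤ sSup (e '' B')

/-- The extension `u^σ` of a (monotone) map `u : L → K` to the completions `(e, C)`, `(d, D)`:
`u^σ(x) = ⋁ {⋀ {u(a) | a ∈ L, p ≤ a} | p ≤ x a filter element}`. -/
def sigmaExt (e : L → C) (d : K → D) (u : L → K) (x : C) : D :=
  sSup {y | ∃ p, IsFilterElement e p ∧ p ≤ x ∧ y = sInf {z | ∃ a, p ≤ e a ∧ z = d (u a)}}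

/-- The extension `u^π` of a (monotone) map `u : L → K` to the completions `(e, C)`, `(d, D)`:
`u^π(x) = ⋀ {⋁ {u(a) | a ∈ L, a ≤ q} | q ≥ x an ideal element}`. -/
def piExt (e : L → C) (d : K → D) (u : L → K) (x : C) : D :=
  sInf {y | ∃ q, IsIdealElement e q ∧ x ≤ q ∧ y = sSup {z | ∃ a, e a ≤ q ∧ z = d (u a)}}

end CanonicalExtension

/-- `Δ`, with the embeddings `η_L : L → Δ(L)`, is a canonical extension functor: each
`(η_L, Δ(L))` is a canonical extension of `L`. Naturality of `η` says that the complete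
homomorphism `Δ(u)` lifts the homomorphism `u`. -/
def IsCanonicalExtensionFunctor (Δ : BddLat.{u} ⥤ CompleteLat.{u})
    (η : 𝟭 BddLat.{u} ⟶ Δ ⋙ forget₂ CompleteLat.{u} BddLat.{u}) : Prop :=
  ∀ L : BddLat.{u}, IsCanonicalExtension (L := L) (C := Δ.obj L) (η.app L).hom

end LatDual

end

/-! On a reflexive graph `(X, E)` the MPE's are the formal concepts of the context `(X, X, ¬E)`, so
they form a complete lattice. On `SPH(L)` the meet of the maps `ē_a` over `a ∈ f⁻¹(1)` has 1-set
`{g | f ≤₁ g}`, and `φ⁻¹(1)` is closed upwards in `≤₁` for every MPE `φ`; hence `φ` is the join of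
these meets over `f ∈ φ⁻¹(1)`, which gives one half of density, and the other half is dual.
Compactness is the separation of a filter from a disjoint ideal by an SPH.

An ultrafilter on `SPH(L)` converges to the SPH whose values are those taken ultrafilter-almost
everywhere. The resulting compactness argument extends every partial morphism `D̄(L) → 2` to some
`ē_a`, so the MPM's of `D̄(L)` are exactly the evaluation maps and `L ≅ Ē(D̄(L))`.

A complete homomorphism out of a dense completion agrees with both the `σ`- and the `π`-extension of
its restriction to `L`, and compactness makes the `σ`-extension of the identity an isomorphism
between any two canonical extensions; hence canonical extension functors are unique. -/

namespace LatDual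

/-! ### Partial maps -/

section PartialMap

variable {X : Type u} {φ ψ : X →. Bool} {A B : Set X}

theorem disjoint_oneSet_zeroSet (φ : X →. Bool) : Disjoint (oneSet φ) (zeroSet φ) :=
  Set.disjoint_left.2 fun _ h1 h0 => absurd (Part.mem_unique h1 h0) (by decide)

theorem eq_of_oneSet_eq_of_zeroSet_eq (h1 : oneSet φ = oneSet ψ) (h0 : zeroSet φ = zeroSet ψ) :
    φ = ψ :=
  PFun.ext fun x s => by
    cases s
    exacts [Set.ext_iff.1 h0 x, Set.ext_iff.1 h1 x]

theorem extends_iff :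
    Extends ψ φ ↔ oneSet φ ⊆ oneSet ψ ∧ zeroSet φ ⊆ zeroSet ψ := by
  refine ⟨fun h => ⟨fun x => h x true, fun x => h x false⟩, fun h x s hs => ?_⟩
  cases s
  exacts [h.2 hs, h.1 hs]

theorem oneSet_pairMap (A B : Set X) : oneSet (pairMap A B) = A :=
  Set.ext fun _ => true_mem_pairMap

theorem zeroSet_pairMap (h : Disjoint A B) : zeroSet (pairMap A B) = B :=
  Set.ext fun _ =>
    false_mem_pairMap.trans (and_iff_left_of_imp fun hB hA => Set.disjoint_left.1 h hA hB)

theorem ePreserving_iff {E : X → X → Prop} :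
    EPreserving E φ ↔ zeroSet φ ⊆ upperPolar Eᶜ (oneSet φ) := by
  refine ⟨fun h y hy x hx => h.not_rel hx hy, fun h x y hxy s hs t ht => ?_⟩
  cases s
  · exact Bool.false_le t
  · cases t
    · exact absurd hxy (h ht hs)
    · exact le_rfl

end PartialMap

/-! ### Maximal partial `E`-preserving maps as formal concepts -/

section MPE

variable {X : Type u} {E : X → X → Prop}

theorem disjoint_upperPolar (r : X → X → Prop) [Std.Irrefl r] (A : Set X) :
    Disjoint A (upperPolar r A) :=
  Set.disjoint_left.2 fun x hx hx' => Std.Irrefl.irrefl x (hx' hx)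

theorem disjoint_lowerPolar (r : X → X → Prop) [Std.Irrefl r] (B : Set X) :
    Disjoint (lowerPolar r B) B :=
  Set.disjoint_left.2 fun x hx hx' => Std.Irrefl.irrefl x (hx hx')

variable [Std.Refl E] {φ ψ : X →. Bool}

theorem IsMPE.upperPolar_oneSet (h : IsMPE E φ) : upperPolar Eᶜ (oneSet φ) = zeroSet φ := by
  have hpres : EPreserving E (pairMap (oneSet φ) (upperPolar Eᶜ (oneSet φ))) :=
    EPreserving.pairMap fun x hx y (hy : y ∈ upperPolar Eᶜ _) => hy hx
  have hmax := h.2 _ hpres (extends_pairMap rfl (ePreserving_iff.1 h.1))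
  rw [← zeroSet_pairMap (disjoint_upperPolar Eᶜ (oneSet φ)), hmax]

theorem IsMPE.lowerPolar_zeroSet (h : IsMPE E φ) : lowerPolar Eᶜ (zeroSet φ) = oneSet φ := by
  have hpres : EPreserving E (pairMap (lowerPolar Eᶜ (zeroSet φ)) (zeroSet φ)) :=
    EPreserving.pairMap fun x (hx : x ∈ lowerPolar Eᶜ _) y hy => hx hy
  have hsub := subset_upperPolar_iff_subset_lowerPolar.1 (ePreserving_iff.1 h.1)
  have hmax := h.2 _ hpres (extends_iff.2 ⟨hsub.trans (oneSet_pairMap _ _).ge,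
    (zeroSet_pairMap (disjoint_lowerPolar Eᶜ (zeroSet φ))).ge⟩)
  rw [← oneSet_pairMap (lowerPolar Eᶜ (zeroSet φ)) (zeroSet φ), hmax]

theorem isMPE_iff :
    IsMPE E φ ↔ upperPolar Eᶜ (oneSet φ) = zeroSet φ ∧ lowerPolar Eᶜ (zeroSet φ) = oneSet φ := by
  refine ⟨fun h => ⟨h.upperPolar_oneSet, h.lowerPolar_zeroSet⟩, fun ⟨h0, h1⟩ =>
    ⟨ePreserving_iff.2 h0.ge, fun ψ hψ hext => ?_⟩⟩
  rw [ePreserving_iff] at hψ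
  rw [extends_iff] at hext
  refine eq_of_oneSet_eq_of_zeroSet_eq (subset_antisymm ?_ hext.1) (subset_antisymm ?_ hext.2)
  · rw [← h1, ← subset_upperPolar_iff_subset_lowerPolar]
    exact hext.2.trans hψ
  · rw [← h0]
    exact hψ.trans (upperPolar_anti _ hext.1)

/-- MPE's are the formal concepts of the context `(X, X, ¬E)`: `φ` corresponds to the concept with
extent `φ⁻¹(1)` and intent `φ⁻¹(0)`. -/
noncomputable def MPE.orderIsoConcept (E : X → X → Prop) [Std.Refl E] :
    MPE E ≃o Concept X X Eᶜ where
  toFun φ := ⟨oneSet φ.1, zeroSet φ.1, φ.2.upperPolar_oneSet, φ.2.lowerPolar_zeroSet⟩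
  invFun c := MPE.mk (pairMap c.extent c.intent) <| isMPE_iff.2 <| by
    rw [oneSet_pairMap, zeroSet_pairMap c.disjoint_extent_intent]
    exact ⟨c.upperPolar_extent, c.lowerPolar_intent⟩
  left_inv φ := Subtype.ext <| eq_of_oneSet_eq_of_zeroSet_eq (oneSet_pairMap _ _)
    (zeroSet_pairMap (disjoint_oneSet_zeroSet φ.1))
  right_inv _ := Concept.ext (oneSet_pairMap _ _)
  map_rel_iff' := Iff.rfl

theorem MPE.le_iff_zeroSet_subset {φ ψ : MPE E} : φ ≤ ψ ↔ zeroSet ψ.1 ⊆ zeroSet φ.1 :=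
  (Concept.intent_subset_intent_iff (c := orderIsoConcept E ψ) (d := orderIsoConcept E φ)).symm

theorem MPE.isLUB_iff {S : Set (MPE E)} {φ : MPE E} :
    IsLUB S φ ↔ zeroSet φ.1 = ⋂ ψ ∈ S, zeroSet ψ.1 := by
  have hsSup : IsLUB S φ ↔ sSup (orderIsoConcept E '' S) = orderIsoConcept E φ := by
    rw [← (orderIsoConcept E).isLUB_image']
    exact ⟨IsLUB.sSup_eq, fun h => h ▸ isLUB_sSup _⟩
  rw [hsSup, ← Concept.intent_injective.eq_iff, Concept.intent_sSup, Set.biInter_image, eq_comm]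
  rfl

theorem MPE.isGLB_iff {S : Set (MPE E)} {φ : MPE E} :
    IsGLB S φ ↔ oneSet φ.1 = ⋂ ψ ∈ S, oneSet ψ.1 := by
  have hsInf : IsGLB S φ ↔ sInf (orderIsoConcept E '' S) = orderIsoConcept E φ := by
    rw [← (orderIsoConcept E).isGLB_image']
    exact ⟨IsGLB.sInf_eq, fun h => h ▸ isGLB_sInf _⟩
  rw [hsInf, ← Concept.extent_injective.eq_iff, Concept.extent_sInf, Set.biInter_image, eq_comm]
  rfl

theorem MPE.exists_isLUB (S : Set (MPE E)) : ∃ φ, IsLUB S φ :=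
  ⟨_, (orderIsoConcept E).isLUB_image.1 (isLUB_sSup _)⟩

theorem MPE.exists_isGLB (S : Set (MPE E)) : ∃ φ, IsGLB S φ :=
  ⟨_, (orderIsoConcept E).isGLB_image.1 (isGLB_sInf _)⟩

end MPE

/-! ### Stability in reflexive graphs with property (Ti) -/

section Graph

variable {X Y : Type u} {E : X → X → Prop} {EX : X → X → Prop} {EY : Y → Y → Prop} {α : X → Y}

theorem le₁_iff_forall {x y : X} : le₁ E x y ↔ ∀ z, E y z → E x z := by
  simp only [le₁, not_exists, not_and_not_right]

theorem le₂_iff_forall {x y : X} : le₂ E x y ↔ ∀ z, E z y → E z x := by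
  simp only [le₂, not_exists, not_and_not_right]

theorem le₁_trans {x y z : X} (hxy : le₁ E x y) (hyz : le₁ E y z) : le₁ E x z :=
  le₁_iff_forall.2 fun w hw => le₁_iff_forall.1 hxy w (le₁_iff_forall.1 hyz w hw)

theorem le₂_trans {x y z : X} (hxy : le₂ E x y) (hyz : le₂ E y z) : le₂ E x z :=
  le₂_iff_forall.2 fun w hw => le₂_iff_forall.1 hxy w (le₂_iff_forall.1 hyz w hw)

theorem ellMap_upward {B : Set X} ⦃x y : X⦄ (h : le₁ E x y) (hx : x ∈ ellMap E B) :
    y ∈ ellMap E B :=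
  fun z hz hyz => hx z hz (le₁_trans h hyz)

theorem rMap_upward {A : Set X} ⦃x y : X⦄ (h : le₂ E x y) (hx : x ∈ rMap E A) :
    y ∈ rMap E A :=
  fun z hz hyz => hx z hz (le₂_trans h hyz)

theorem IsMPE.oneSet_upward [Std.Refl E] {φ : X →. Bool} (hφ : IsMPE E φ) ⦃x y : X⦄
    (h : le₁ E x y) (hx : x ∈ oneSet φ) : y ∈ oneSet φ := by
  rw [← hφ.lowerPolar_zeroSet] at hx ⊢
  exact fun z hz hyz => hx hz (le₁_iff_forall.1 h z hyz)

theorem IsMPE.zeroSet_upward [Std.Refl E] {φ : X →. Bool} (hφ : IsMPE E φ) ⦃x y : X⦄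
    (h : le₂ E x y) (hx : x ∈ zeroSet φ) : y ∈ zeroSet φ := by
  rw [← hφ.upperPolar_oneSet] at hx ⊢
  exact fun z hz hzy => hx hz (le₂_iff_forall.1 h z hzy)

/-- A reflexive graph with the property (Ti) of Craig, Haviar and Priestley: every edge `x → y` can
be moved to a single point above `x` in `≤₁` and above `y` in `≤₂`. This is what relates the maps
`ℓ` and `r`, defined through `≤₁` and `≤₂`, to the polarity of the relation `¬E`. -/
class IsTi (E : X → X → Prop) : Prop extends Std.Refl E where
  exists_of_rel : ∀ {x y}, E x y → ∃ z, le₁ E x z ∧ le₂ E y z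

theorem IsTi.of_surjective [hY : IsTi EY] (hs : Function.Surjective α)
    (h : ∀ x y, EY (α x) (α y) ↔ EX x y) : IsTi EX where
  refl x := (h x x).1 (hY.refl _)
  exists_of_rel {x y} hxy := by
    obtain ⟨z, hz1, hz2⟩ := hY.exists_of_rel ((h x y).2 hxy)
    obtain ⟨z, rfl⟩ := hs z
    refine ⟨z, ?_, ?_⟩
    · simpa only [le₁_iff_forall, hs.forall, h] using hz1
    · simpa only [le₂_iff_forall, hs.forall, h] using hz2

theorem ellMap_eq_lowerPolar [IsTi E] {B : Set X} (hB : ∀ ⦃x y⦄, le₂ E x y → x ∈ B → y ∈ B) :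
    ellMap E B = lowerPolar Eᶜ B := by
  refine subset_antisymm (fun x hx y hy hxy => ?_)
    fun x hx y hy hxy => hx hy (le₁_iff_forall.1 hxy y (Std.Refl.refl y))
  obtain ⟨z, hxz, hyz⟩ := IsTi.exists_of_rel hxy
  exact hx z (hB hyz hy) hxz

theorem rMap_eq_upperPolar [IsTi E] {A : Set X} (hA : ∀ ⦃x y⦄, le₁ E x y → x ∈ A → y ∈ A) :
    rMap E A = upperPolar Eᶜ A := by
  refine subset_antisymm (fun y hy x hx hxy => ?_)
    fun y hy x hx hyx => hy hx (le₂_iff_forall.1 hyx x (Std.Refl.refl x))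
  obtain ⟨z, hxz, hyz⟩ := IsTi.exists_of_rel hxy
  exact hy z (hA hxz hx) hyz

theorem IsMPE.ellMap_zeroSet [IsTi E] {φ : X →. Bool} (h : IsMPE E φ) :
    ellMap E (zeroSet φ) = oneSet φ := by
  rw [ellMap_eq_lowerPolar h.zeroSet_upward, h.lowerPolar_zeroSet]

theorem IsMPE.rMap_oneSet [IsTi E] {φ : X →. Bool} (h : IsMPE E φ) :
    rMap E (oneSet φ) = zeroSet φ := by
  rw [rMap_eq_upperPolar h.oneSet_upward, h.upperPolar_oneSet]

theorem isMPE_iff_ellMap_rMap [IsTi E] {φ : X →. Bool} :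
    IsMPE E φ ↔ ellMap E (zeroSet φ) = oneSet φ ∧ rMap E (oneSet φ) = zeroSet φ := by
  refine ⟨fun h => ⟨h.ellMap_zeroSet, h.rMap_oneSet⟩, fun ⟨h1, h0⟩ => isMPE_iff.2 ?_⟩
  rw [← ellMap_eq_lowerPolar (h0 ▸ rMap_upward), ← rMap_eq_upperPolar (h1 ▸ ellMap_upward)]
  exact ⟨h0, h1⟩

theorem IsLGraphMorphism.isMPE_pcomp [IsTi EX] [IsTi EY] (hα : IsLGraphMorphism EX EY α)
    {φ : Y →. Bool} (hφ : IsMPE EY φ) : IsMPE EX (pcomp φ α) := by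
  have hone : EllStable EY (oneSet φ) := by rw [EllStable, hφ.rMap_oneSet, hφ.ellMap_zeroSet]
  have hzero : RStable EY (zeroSet φ) := by rw [RStable, hφ.ellMap_zeroSet, hφ.rMap_oneSet]
  exact isMPE_iff_ellMap_rMap.2
    ⟨(hα.preimage_ellMap _ hzero).symm.trans (congrArg (α ⁻¹' ·) hφ.ellMap_zeroSet),
      (hα.preimage_rMap _ hone).symm.trans (congrArg (α ⁻¹' ·) hφ.rMap_oneSet)⟩

theorem isLGraphMorphism_of_surjective (hs : Function.Surjective α)
    (h : ∀ x y, EY (α x) (α y) ↔ EX x y) : IsLGraphMorphism EX EY α := by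
  have h1 : ∀ x y, le₁ EY (α x) (α y) ↔ le₁ EX x y := fun x y => by
    simp only [le₁_iff_forall, hs.forall, h]
  have h2 : ∀ x y, le₂ EY (α x) (α y) ↔ le₂ EX x y := fun x y => by
    simp only [le₂_iff_forall, hs.forall, h]
  refine ⟨fun x y => (h1 x y).2, fun x y => (h2 x y).2, fun A _ => ?_, fun A _ => ?_⟩
  · ext x
    simp only [rMap, Set.mem_preimage, Set.mem_ofPred_eq, hs.forall, h2]
  · ext x
    simp only [ellMap, Set.mem_preimage, Set.mem_ofPred_eq, hs.forall, h1]

theorem isLGraphMorphism_of_exists_lift [IsTi EX] [IsTi EY]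
    (map_rel : ∀ x y, EX x y → EY (α x) (α y))
    (map_le₁ : ∀ x y, le₁ EX x y → le₁ EY (α x) (α y))
    (map_le₂ : ∀ x y, le₂ EX x y → le₂ EY (α x) (α y))
    (lift_left : ∀ x y, EY y (α x) → ∃ z, EX z x ∧ le₁ EY y (α z))
    (lift_right : ∀ x y, EY (α x) y → ∃ z, EX x z ∧ le₂ EY y (α z)) :
    IsLGraphMorphism EX EY α where
  map_le₁ := map_le₁
  map_le₂ := map_le₂
  preimage_rMap A hA := by
    have hup : ∀ ⦃x y⦄, le₁ EY x y → x ∈ A → y ∈ A := by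
      rw [← show _ = A from hA]
      exact ellMap_upward
    rw [rMap_eq_upperPolar hup, rMap_eq_upperPolar (A := α ⁻¹' A)
      fun _ _ h => hup (map_le₁ _ _ h)]
    refine subset_antisymm (fun x hx z hz hzx => hx hz (map_rel z x hzx)) fun x hx y hy hyx => ?_
    obtain ⟨z, hzx, hyz⟩ := lift_left x y hyx
    exact hx (hup hyz hy) hzx
  preimage_ellMap A hA := by
    have hup : ∀ ⦃x y⦄, le₂ EY x y → x ∈ A → y ∈ A := by
      rw [← show _ = A from hA]
      exact rMap_upward
    rw [ellMap_eq_lowerPolar hup, ellMap_eq_lowerPolar (B := α ⁻¹' A)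
      fun _ _ h => hup (map_le₂ _ _ h)]
    refine subset_antisymm (fun x hx z hz hxz => hx hz (map_rel x z hxz)) fun x hx y hy hxy => ?_
    obtain ⟨z, hxz, hyz⟩ := lift_right x y hxy
    exact hx (hup hyz hy) hxz

end Graph

/-! ### Filters, ideals and special partial homomorphisms -/

section FilterIdeal

theorem isPFilter_of_inf_mem {P : Type*} [SemilatticeInf P] {F : Set P} (hne : F.Nonempty)
    (hup : IsUpperSet F) (hinf : ∀ {a b}, a ∈ F → b ∈ F → a ⊓ b ∈ F) : Order.IsPFilter F :=
  Order.IsPFilter.of_def hne (fun _ ha _ hb => ⟨_, hinf ha hb, inf_le_left, inf_le_right⟩)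
    fun h => hup h

theorem isIdeal_of_sup_mem {P : Type*} [SemilatticeSup P] {I : Set P} (hne : I.Nonempty)
    (hdown : IsLowerSet I) (hsup : ∀ {a b}, a ∈ I → b ∈ I → a ⊔ b ∈ I) : Order.IsIdeal I where
  IsLowerSet := hdown
  Nonempty := hne
  Directed _ ha _ hb := ⟨_, hsup ha hb, le_sup_left, le_sup_right⟩

theorem isIdeal_lowerClosure_image {P Q : Type*} [Preorder P] [Preorder Q] {v : P → Q}
    (hv : Monotone v) {I : Set P} (hI : Order.IsIdeal I) :
    Order.IsIdeal (lowerClosure (v '' I) : Set Q) where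
  IsLowerSet := (lowerClosure (v '' I)).lower
  Nonempty := (hI.Nonempty.image v).mono subset_lowerClosure
  Directed := by
    rintro b ⟨_, ⟨a, ha, rfl⟩, hba⟩ b' ⟨_, ⟨a', ha', rfl⟩, hba'⟩
    obtain ⟨c, hc, hac, hac'⟩ := hI.Directed a ha a' ha'
    exact ⟨v c, subset_lowerClosure ⟨c, hc, rfl⟩, hba.trans (hv hac), hba'.trans (hv hac')⟩

theorem isPFilter_upperClosure_image {P Q : Type*} [Preorder P] [Preorder Q] {v : P → Q}
    (hv : Monotone v) {F : Set P} (hF : Order.IsPFilter F) :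
    Order.IsPFilter (upperClosure (v '' F) : Set Q) :=
  isIdeal_lowerClosure_image hv.dual hF

variable {L : Type u} [Lattice L] [BoundedOrder L] {f : L →. Bool} {a b : L}

theorem IsSPH.mem_oneSet_of_le (h : IsSPH f) (hab : a ≤ b) (ha : a ∈ oneSet f) : b ∈ oneSet f :=
  h.isPFilter.toPFilter.mem_of_le hab ha

theorem IsSPH.mem_zeroSet_of_le (h : IsSPH f) (hab : a ≤ b) (hb : b ∈ zeroSet f) : a ∈ zeroSet f :=
  h.isIdeal.IsLowerSet hab hb

theorem IsSPH.inf_mem_oneSet (h : IsSPH f) (ha : a ∈ oneSet f) (hb : b ∈ oneSet f) :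
    a ⊓ b ∈ oneSet f :=
  h.map_inf a b true ha true hb

theorem IsSPH.sup_mem_zeroSet (h : IsSPH f) (ha : a ∈ zeroSet f) (hb : b ∈ zeroSet f) :
    a ⊔ b ∈ zeroSet f :=
  h.map_sup a b false ha false hb

theorem IsSPH.pcomp {K : Type u} [Lattice K] [BoundedOrder K] {g : K →. Bool} (h : IsSPH g)
    (v : BoundedLatticeHom L K) : IsSPH (pcomp g v) where
  map_bot := by simpa only [LatDual.pcomp, map_bot] using h.map_bot
  map_top := by simpa only [LatDual.pcomp, map_top] using h.map_top
  map_sup a b s hs t ht := by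
    simpa only [LatDual.pcomp, map_sup] using h.map_sup _ _ s hs t ht
  map_inf a b s hs t ht := by
    simpa only [LatDual.pcomp, map_inf] using h.map_inf _ _ s hs t ht
  isPFilter := isPFilter_of_inf_mem
    ⟨⊤, (congrArg (true ∈ g ·) (map_top v)).mpr h.map_top⟩
    (fun _ _ hab => h.mem_oneSet_of_le (OrderHomClass.mono v hab))
    (fun ha hb => by
      simpa only [oneSet, LatDual.pcomp, Set.mem_ofPred_eq, map_inf] using h.inf_mem_oneSet ha hb)
  isIdeal := isIdeal_of_sup_mem
    ⟨⊥, (congrArg (false ∈ g ·) (map_bot v)).mpr h.map_bot⟩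
    (fun _ _ hab => h.mem_zeroSet_of_le (OrderHomClass.mono v hab))
    (fun ha hb => by
      simpa only [zeroSet, LatDual.pcomp, Set.mem_ofPred_eq, map_sup] using h.sup_mem_zeroSet ha hb)

end FilterIdeal

section SPH

variable {L K : BddLat.{u}}

theorem SPH.rel_iff_disjoint {f g : SPH L} :
    SPH.E f g ↔ Disjoint (oneSet f.1) (zeroSet g.1) :=
  SPH.rel_iff.trans Set.disjoint_left.symm

theorem SPH.exists_oneSet_eq_zeroSet_eq {F I : Set L} (hF : Order.IsPFilter F)
    (hI : Order.IsIdeal I) (h : Disjoint F I) :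
    ∃ f : SPH L, oneSet f.1 = F ∧ zeroSet f.1 = I :=
  ⟨SPH.ofPair F I hF hI fun _ ha ha' => Set.disjoint_left.1 h ha ha', oneSet_pairMap F I,
    zeroSet_pairMap h⟩

theorem SPH.exists_mem_zeroSet_of_notMem_oneSet {f : SPH L} {a : L} (ha : a ∉ oneSet f.1) :
    ∃ g : SPH L, oneSet g.1 = oneSet f.1 ∧ a ∈ zeroSet g.1 := by
  obtain ⟨g, hg1, hg0⟩ := SPH.exists_oneSet_eq_zeroSet_eq f.2.isPFilter
    (Order.Ideal.principal a).isIdeal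
    (Set.disjoint_left.2 fun b hb hba => ha (f.2.mem_oneSet_of_le hba hb))
  exact ⟨g, hg1, hg0.ge le_rfl⟩

theorem SPH.exists_mem_oneSet_of_notMem_zeroSet {f : SPH L} {a : L} (ha : a ∉ zeroSet f.1) :
    ∃ g : SPH L, a ∈ oneSet g.1 ∧ zeroSet g.1 = zeroSet f.1 := by
  obtain ⟨g, hg1, hg0⟩ := SPH.exists_oneSet_eq_zeroSet_eq (Order.PFilter.principal a).isPFilter
    f.2.isIdeal (Set.disjoint_left.2 fun b hab hb => ha (f.2.mem_zeroSet_of_le hab hb))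
  exact ⟨g, hg1.ge le_rfl, hg0⟩

instance (L : BddLat.{u}) : IsTi (SPH.E (L := L)) where
  refl f := SPH.rel_iff_disjoint.2 (disjoint_oneSet_zeroSet f.1)
  exists_of_rel {f g} h := by
    obtain ⟨k, hk1, hk0⟩ := SPH.exists_oneSet_eq_zeroSet_eq f.2.isPFilter g.2.isIdeal
      (SPH.rel_iff_disjoint.1 h)
    exact ⟨k, SPH.le₁_iff.2 hk1.ge, SPH.le₂_iff.2 hk0.ge⟩

instance (X : LGraph.{u}) : IsTi X.E :=
  let ⟨_, ⟨e⟩⟩ := X.isLGraph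
  IsTi.of_surjective e.surjective fun _ _ => e.map_rel_iff

instance (X : TopLGraph.{u}) : IsTi X.E :=
  let ⟨_, e, he⟩ := X.isLGraph
  IsTi.of_surjective e.surjective he

/-- Composition of SPH's with a homomorphism; this is the action of `D̄` on morphisms. -/
def SPH.comap (v : BoundedLatticeHom L K) (f : SPH K) : SPH L :=
  SPH.mk (pcomp f.1 v) (f.2.pcomp v)

theorem SPH.comap_rel_comap_iff {v : BoundedLatticeHom L K} (hv : Function.Surjective v)
    {f g : SPH K} : SPH.E (SPH.comap v f) (SPH.comap v g) ↔ SPH.E f g :=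
  (hv.forall (p := fun b => ∀ s ∈ f.1 b, ∀ t ∈ g.1 b, s ≤ t)).symm

theorem SPH.exists_rel_le₁_comap (v : BoundedLatticeHom L K) (f : SPH K) (g : SPH L)
    (h : SPH.E g (SPH.comap v f)) : ∃ k, SPH.E k f ∧ le₁ SPH.E g (SPH.comap v k) := by
  obtain ⟨k, hk1, hk0⟩ := SPH.exists_oneSet_eq_zeroSet_eq
    (isPFilter_upperClosure_image (OrderHomClass.mono v) g.2.isPFilter) f.2.isIdeal <| by
      refine Set.disjoint_left.2 ?_
      rintro b ⟨_, ⟨a, ha, rfl⟩, hab⟩ hb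
      exact SPH.rel_iff.1 h a ha (f.2.mem_zeroSet_of_le hab hb)
  refine ⟨k, SPH.rel_iff_disjoint.2 (hk0 ▸ disjoint_oneSet_zeroSet k.1),
    SPH.le₁_iff.2 fun a ha => ?_⟩
  exact hk1.ge (subset_upperClosure (Set.mem_image_of_mem v ha))

theorem SPH.exists_rel_le₂_comap (v : BoundedLatticeHom L K) (f : SPH K) (g : SPH L)
    (h : SPH.E (SPH.comap v f) g) : ∃ k, SPH.E f k ∧ le₂ SPH.E g (SPH.comap v k) := by
  obtain ⟨k, hk1, hk0⟩ := SPH.exists_oneSet_eq_zeroSet_eq f.2.isPFilter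
    (isIdeal_lowerClosure_image (OrderHomClass.mono v) g.2.isIdeal) <| by
      refine Set.disjoint_left.2 ?_
      rintro b hb ⟨_, ⟨a, ha, rfl⟩, hba⟩
      exact SPH.rel_iff.1 h a (f.2.mem_oneSet_of_le hba hb) ha
  refine ⟨k, SPH.rel_iff_disjoint.2 (hk1 ▸ disjoint_oneSet_zeroSet k.1),
    SPH.le₂_iff.2 fun a ha => ?_⟩
  exact hk0.ge (subset_lowerClosure (Set.mem_image_of_mem v ha))

theorem SPH.isLGraphMorphism_comap (v : BoundedLatticeHom L K) :
    IsLGraphMorphism SPH.E SPH.E (SPH.comap v) :=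
  isLGraphMorphism_of_exists_lift (fun _ _ h a => h (v a))
    (fun _ _ h => SPH.le₁_iff.2 fun a ha => SPH.le₁_iff.1 h (show v a ∈ _ from ha))
    (fun _ _ h => SPH.le₂_iff.2 fun a ha => SPH.le₂_iff.1 h (show v a ∈ _ from ha))
    (SPH.exists_rel_le₁_comap v) (SPH.exists_rel_le₂_comap v)

theorem SPH.isClosed_mem (a : L) (s : Bool) : IsClosed {f : SPH L | s ∈ f.1 a} :=
  ⟨TopologicalSpace.isOpen_generateFrom_of_mem ⟨a, s, rfl⟩⟩

theorem SPH.continuous_comap (v : BoundedLatticeHom L K) : Continuous (SPH.comap v) := by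
  refine continuous_generateFrom_iff.2 ?_
  rintro _ ⟨a, s, rfl⟩
  exact (SPH.isClosed_mem (v a) s).isOpen_compl

end SPH

theorem dbarWellDefined : DbarWellDefined.{u} where
  isSPH v f := f.2.pcomp v.hom
  isMorphism v := SPH.isLGraphMorphism_comap v.hom
  continuous v := SPH.continuous_comap v.hom

theorem gbarWellDefined : GbarWellDefined.{u} where
  exists_isLUB _ := MPE.exists_isLUB
  exists_isGLB _ := MPE.exists_isGLB
  isMPE α φ := α.2.isMPE_pcomp φ.2
  isLUB α S φ h := by
    rw [MPE.isLUB_iff, Set.biInter_image]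
    exact (congrArg (α.1 ⁻¹' ·) (MPE.isLUB_iff.1 h)).trans Set.preimage_iInter₂
  isGLB α S φ h := by
    rw [MPE.isGLB_iff, Set.biInter_image]
    exact (congrArg (α.1 ⁻¹' ·) (MPE.isGLB_iff.1 h)).trans Set.preimage_iInter₂

/-! ### Evaluation maps -/

section Eval

variable {L : BddLat.{u}}

theorem isMPE_evalMap (a : L) : IsMPE SPH.E (evalMap a) := by
  refine isMPE_iff.2 ⟨subset_antisymm (fun g hg => ?_) fun g hg f hf h => SPH.rel_iff.1 h a hf hg,
    subset_antisymm (fun f hf => ?_) fun f hf g hg h => SPH.rel_iff.1 h a hf hg⟩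
  · by_contra hga
    obtain ⟨f, hfa, hf⟩ := SPH.exists_mem_oneSet_of_notMem_zeroSet hga
    exact hg hfa (SPH.rel_iff_disjoint.2 (hf ▸ disjoint_oneSet_zeroSet f.1))
  · by_contra hfa
    obtain ⟨g, hg, hga⟩ := SPH.exists_mem_zeroSet_of_notMem_oneSet hfa
    exact hf hga (SPH.rel_iff_disjoint.2 (hg ▸ disjoint_oneSet_zeroSet g.1))

theorem oneSet_evalMap_subset_iff {a b : L} :
    oneSet (evalMap a) ⊆ oneSet (evalMap b) ↔ a ≤ b := by
  refine ⟨fun h => ?_, fun h f hf => f.2.mem_oneSet_of_le h hf⟩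
  by_contra hab
  obtain ⟨f, hf1, hf0⟩ := SPH.exists_oneSet_eq_zeroSet_eq (Order.PFilter.principal a).isPFilter
    (Order.Ideal.principal b).isIdeal (Set.disjoint_left.2 fun c hac hcb => hab (le_trans hac hcb))
  exact Set.disjoint_left.1 (disjoint_oneSet_zeroSet f.1) (h (hf1.ge le_rfl)) (hf0.ge le_rfl)

theorem zeroSet_evalMap_sup (a b : L) :
    zeroSet (evalMap (a ⊔ b)) = zeroSet (evalMap a) ∩ zeroSet (evalMap b) :=
  Set.ext fun f => ⟨fun h => ⟨f.2.mem_zeroSet_of_le le_sup_left h,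
    f.2.mem_zeroSet_of_le le_sup_right h⟩, fun h => f.2.sup_mem_zeroSet h.1 h.2⟩

theorem oneSet_evalMap_inf (a b : L) :
    oneSet (evalMap (a ⊓ b)) = oneSet (evalMap a) ∩ oneSet (evalMap b) :=
  Set.ext fun f => ⟨fun h => ⟨f.2.mem_oneSet_of_le inf_le_left h,
    f.2.mem_oneSet_of_le inf_le_right h⟩, fun h => f.2.inf_mem_oneSet h.1 h.2⟩

theorem zeroSet_evalMap_top (L : BddLat.{u}) : zeroSet (evalMap (⊤ : L)) = ∅ :=
  Set.eq_empty_of_forall_notMem fun f =>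
    Set.disjoint_left.1 (disjoint_oneSet_zeroSet f.1) f.2.map_top

theorem oneSet_evalMap_bot (L : BddLat.{u}) : oneSet (evalMap (⊥ : L)) = ∅ :=
  Set.eq_empty_of_forall_notMem fun f =>
    Set.disjoint_right.1 (disjoint_oneSet_zeroSet f.1) f.2.map_bot

theorem SPH.exists_ultrafilter_le_nhds (U : Ultrafilter (SPH L)) :
    ∃ g : SPH L, ↑U ≤ nhds g ∧ ∀ a s, s ∈ g.1 a ↔ ∀ᶠ f : SPH L in U, s ∈ f.1 a := by
  have hF : Order.IsPFilter {a : L | ∀ᶠ f : SPH L in U, a ∈ oneSet f.1} := isPFilter_of_inf_mem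
    ⟨⊤, .of_forall fun f => f.2.map_top⟩
    (fun _ _ hab ha => ha.mono fun f => f.2.mem_oneSet_of_le hab)
    (fun ha hb => (ha.and hb).mono fun f hf => f.2.inf_mem_oneSet hf.1 hf.2)
  have hI : Order.IsIdeal {a : L | ∀ᶠ f : SPH L in U, a ∈ zeroSet f.1} := isIdeal_of_sup_mem
    ⟨⊥, .of_forall fun f => f.2.map_bot⟩
    (fun _ _ hab hb => hb.mono fun f => f.2.mem_zeroSet_of_le hab)
    (fun ha hb => (ha.and hb).mono fun f hf => f.2.sup_mem_zeroSet hf.1 hf.2)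
  obtain ⟨g, hg1, hg0⟩ := SPH.exists_oneSet_eq_zeroSet_eq hF hI <|
    Set.disjoint_left.2 fun a h1 h0 =>
      let ⟨f, hf1, hf0⟩ := (Filter.Eventually.and h1 h0).exists
      Set.disjoint_left.1 (disjoint_oneSet_zeroSet f.1) hf1 hf0
  have hg : ∀ a s, s ∈ g.1 a ↔ ∀ᶠ f : SPH L in U, s ∈ f.1 a := by
    rintro a (_ | _)
    exacts [Set.ext_iff.1 hg0 a, Set.ext_iff.1 hg1 a]
  refine ⟨g, ?_, hg⟩
  rw [TopologicalSpace.nhds_generateFrom]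
  refine le_iInf₂ ?_
  rintro _ ⟨hga, a, s, rfl⟩
  rw [Filter.le_principal_iff, Ultrafilter.mem_coe, Ultrafilter.compl_mem_iff_notMem]
  exact fun hU => hga ((hg a s).2 hU)

/-- A Dini-type compactness argument: elementwise limits along ultrafilters stay both in the sets
`{f | f(a) = s}` and in their complements. -/
theorem SPH.exists_forall_mem_of_directedOn {A : Set (SPH L)} (hA : IsClosed A) {s : Bool}
    {D : Set L} (hne : D.Nonempty)
    (hdir : DirectedOn (fun a b => ∀ f : SPH L, s ∈ f.1 a → s ∈ f.1 b) D)
    (hcover : ∀ f ∈ A, ∃ a ∈ D, s ∈ f.1 a) : ∃ a ∈ D, ∀ f ∈ A, s ∈ f.1 a := by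
  by_contra! hnot
  have : Nonempty D := hne.to_subtype
  have hneBot := Filter.iInf_neBot_of_directed'
    (f := fun a : D => Filter.principal {f | f ∈ A ∧ s ∉ f.1 a})
    (fun a b => by
      obtain ⟨c, hc, hac, hbc⟩ := hdir _ a.2 _ b.2
      exact ⟨⟨c, hc⟩, Filter.principal_mono.2 fun f hf => ⟨hf.1, mt (hac f) hf.2⟩,
        Filter.principal_mono.2 fun f hf => ⟨hf.1, mt (hbc f) hf.2⟩⟩)
    fun a => Filter.principal_neBot_iff.2 (hnot a a.2)
  obtain ⟨U, hU⟩ := Ultrafilter.exists_le (⨅ a : D, Filter.principal {f | f ∈ A ∧ s ∉ f.1 a})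
  have hUa : ∀ a : D, ∀ᶠ f in U, f ∈ A ∧ s ∉ f.1 a := fun a =>
    Filter.le_principal_iff.1 (hU.trans (iInf_le _ a))
  obtain ⟨g, hUg, hg⟩ := SPH.exists_ultrafilter_le_nhds U
  have hgA : g ∈ A := isClosed_iff_ultrafilter.1 hA g U hUg
    ((hUa (Classical.arbitrary D)).mono fun _ => And.left)
  obtain ⟨a, haD, hga⟩ := hcover g hgA
  obtain ⟨f, hfa, -, hfa'⟩ := (((hg a s).1 hga).and (hUa ⟨a, haD⟩)).exists
  exact hfa' hfa

theorem IsPartialMorphism.exists_extends_evalMap {φ : SPH L →. Bool}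
    (h : IsPartialMorphism SPH.E φ) : ∃ a, Extends (evalMap a) φ := by
  have hsep : ∀ g ∈ zeroSet φ, ∃ a ∈ zeroSet g.1, ∀ f ∈ oneSet φ, a ∈ oneSet f.1 := fun g hg =>
    SPH.exists_forall_mem_of_directedOn (isClosed_of_isPartialMorphism h true) ⟨⊥, g.2.map_bot⟩
      (g.2.isIdeal.Directed.mono fun {a b : L} hab (f : SPH L) => f.2.mem_oneSet_of_le hab)
      fun f hf => by
        have hfg := h.2.2.not_rel hf hg
        rw [SPH.rel_iff_disjoint, Set.not_disjoint_iff] at hfg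
        exact hfg.imp fun _ => And.symm
  have hdir : DirectedOn (fun a b : L => ∀ f : SPH L, false ∈ f.1 a → false ∈ f.1 b)
      {a | oneSet φ ⊆ oneSet (evalMap a)} := fun a ha b hb =>
    ⟨a ⊓ b, fun f hf => f.2.inf_mem_oneSet (ha hf) (hb hf),
      fun f => f.2.mem_zeroSet_of_le inf_le_left, fun f => f.2.mem_zeroSet_of_le inf_le_right⟩
  obtain ⟨a, ha1, ha0⟩ := SPH.exists_forall_mem_of_directedOn
    (isClosed_of_isPartialMorphism h false) ⟨⊤, fun f _ => f.2.map_top⟩ hdir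
    fun g hg => (hsep g hg).imp fun _ ha => ⟨ha.2, ha.1⟩
  exact ⟨a, extends_iff.2 ⟨ha1, ha0⟩⟩

end Eval

/-! ### Maximal partial morphisms -/

section MPM

theorem IsMPE.isMPM {X : Type u} [TopologicalSpace X] {E : X → X → Prop} {φ : X →. Bool}
    (h : IsMPE E φ) (h1 : IsClosed (oneSet φ)) (h0 : IsClosed (zeroSet φ)) : IsMPM E φ :=
  ⟨isPartialMorphism_of_isClosed h1 h0 h.1, fun ψ hψ => h.2 ψ hψ.2.2⟩

variable {X : TopLGraph.{u}} {L : BddLat.{u}} (e : X.carrier ≃ₜ SPH L)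
  (he : ∀ x y, SPH.E (e x) (e y) ↔ X.E x y)

include he in
theorem isMPE_pcomp_evalMap (a : L) : IsMPE X.E (pcomp (evalMap a) e) :=
  (isLGraphMorphism_of_surjective e.surjective he).isMPE_pcomp (isMPE_evalMap a)

include he in
theorem isMPM_pcomp_evalMap (a : L) : IsMPM X.E (pcomp (evalMap a) e) :=
  (isMPE_pcomp_evalMap e he a).isMPM ((SPH.isClosed_mem a true).preimage e.continuous)
    ((SPH.isClosed_mem a false).preimage e.continuous)

include he in
theorem IsMPM.exists_eq_pcomp_evalMap {φ : X.carrier →. Bool} (hφ : IsMPM X.E φ) :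
    ∃ a, pcomp (evalMap a) e = φ := by
  have hpartial : IsPartialMorphism SPH.E (pcomp φ e.symm) := by
    refine isPartialMorphism_of_isClosed
      ((isClosed_of_isPartialMorphism hφ.1 true).preimage e.symm.continuous)
      ((isClosed_of_isPartialMorphism hφ.1 false).preimage e.symm.continuous)
      fun f g hfg => hφ.1.2.2 _ _ ((he _ _).1 ?_)
    rwa [e.apply_symm_apply, e.apply_symm_apply]
  obtain ⟨a, ha⟩ := hpartial.exists_extends_evalMap
  refine ⟨a, hφ.2 _ (isMPM_pcomp_evalMap e he a).1 fun x s hs => ha (e x) s ?_⟩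
  rwa [pcomp, e.symm_apply_apply]

/-- The MPM's of an `𝓛`-graph with topology are the evaluation maps at the elements of a bounded
lattice `L` whose dual space is isomorphic to it via `e`. -/
noncomputable def MPM.orderIso : L ≃o MPM X.E :=
  RelIso.ofSurjective
    (OrderEmbedding.ofMapLEIff (fun a => MPM.mk _ (isMPM_pcomp_evalMap e he a)) fun _ _ =>
      (Set.preimage_subset_preimage_iff (by simp [e.range_coe])).trans oneSet_evalMap_subset_iff)
    fun φ => (φ.2.exists_eq_pcomp_evalMap e he).imp fun _ => Subtype.ext

theorem IsMPM.isMPE {φ : X.carrier →. Bool} (hφ : IsMPM X.E φ) : IsMPE X.E φ := by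
  obtain ⟨L, e, he⟩ := X.isLGraph
  obtain ⟨a, rfl⟩ := hφ.exists_eq_pcomp_evalMap e he
  exact isMPE_pcomp_evalMap e he a

theorem MPM.le_iff_zeroSet_subset {φ ψ : MPM X.E} : φ ≤ ψ ↔ zeroSet ψ.1 ⊆ zeroSet φ.1 :=
  MPE.le_iff_zeroSet_subset (φ := ⟨φ.1, φ.2.isMPE⟩) (ψ := ⟨ψ.1, ψ.2.isMPE⟩)

theorem MPM.zeroSet_orderIso_sup (a b : L) : zeroSet (orderIso e he (a ⊔ b)).1 =
    zeroSet (orderIso e he a).1 ∩ zeroSet (orderIso e he b).1 :=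
  congrArg (e ⁻¹' ·) (zeroSet_evalMap_sup a b)

theorem MPM.oneSet_orderIso_inf (a b : L) : oneSet (orderIso e he (a ⊓ b)).1 =
    oneSet (orderIso e he a).1 ∩ oneSet (orderIso e he b).1 :=
  congrArg (e ⁻¹' ·) (oneSet_evalMap_inf a b)

theorem MPM.zeroSet_orderIso_top : zeroSet (orderIso e he ⊤).1 = ∅ :=
  congrArg (e ⁻¹' ·) (zeroSet_evalMap_top L)

theorem MPM.oneSet_orderIso_bot : oneSet (orderIso e he ⊥).1 = ∅ :=
  congrArg (e ⁻¹' ·) (oneSet_evalMap_bot L)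

variable {φ ψ χ : MPM X.E}

theorem MPM.isLUB_iff : IsLUB {φ, ψ} χ ↔ zeroSet χ.1 = zeroSet φ.1 ∩ zeroSet ψ.1 := by
  obtain ⟨L, e, he⟩ := X.isLGraph
  obtain ⟨a, rfl⟩ := (orderIso e he).surjective φ
  obtain ⟨b, rfl⟩ := (orderIso e he).surjective ψ
  have hlub : IsLUB {orderIso e he a, orderIso e he b} (orderIso e he (a ⊔ b)) := by
    rw [← Set.image_pair, OrderIso.isLUB_image']
    exact isLUB_pair
  rw [← zeroSet_orderIso_sup]
  exact ⟨fun h => by rw [h.unique hlub], fun h =>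
    le_antisymm (le_iff_zeroSet_subset.2 h.ge) (le_iff_zeroSet_subset.2 h.le) ▸ hlub⟩

theorem MPM.isGLB_iff : IsGLB {φ, ψ} χ ↔ oneSet χ.1 = oneSet φ.1 ∩ oneSet ψ.1 := by
  obtain ⟨L, e, he⟩ := X.isLGraph
  obtain ⟨a, rfl⟩ := (orderIso e he).surjective φ
  obtain ⟨b, rfl⟩ := (orderIso e he).surjective ψ
  have hglb : IsGLB {orderIso e he a, orderIso e he b} (orderIso e he (a ⊓ b)) := by
    rw [← Set.image_pair, OrderIso.isGLB_image']
    exact isGLB_pair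
  rw [← oneSet_orderIso_inf]
  exact ⟨fun h => by rw [h.unique hglb],
    fun h => le_antisymm (α := MPM X.E) h.ge h.le ▸ hglb⟩

theorem MPM.isTop_iff : IsTop φ ↔ zeroSet φ.1 = ∅ := by
  obtain ⟨L, e, he⟩ := X.isLGraph
  refine ⟨fun h => Set.subset_empty_iff.1 ?_, fun h ψ => le_iff_zeroSet_subset.2 ?_⟩
  · rw [← zeroSet_orderIso_top e he, ← le_iff_zeroSet_subset]
    exact h _
  · rw [h]
    exact Set.empty_subset _

theorem MPM.isBot_iff : IsBot φ ↔ oneSet φ.1 = ∅ := by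
  obtain ⟨L, e, he⟩ := X.isLGraph
  refine ⟨fun h => Set.subset_empty_iff.1 ?_, fun h ψ => h.trans_subset (Set.empty_subset _)⟩
  rw [← oneSet_orderIso_bot e he]
  exact h _

end MPM

theorem ebarWellDefined : EbarWellDefined.{u} where
  exists_isLUB X φ ψ := by
    obtain ⟨L, e, he⟩ := X.isLGraph
    obtain ⟨a, rfl⟩ := (MPM.orderIso e he).surjective φ
    obtain ⟨b, rfl⟩ := (MPM.orderIso e he).surjective ψ
    exact ⟨_, MPM.isLUB_iff.2 (MPM.zeroSet_orderIso_sup e he a b)⟩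
  exists_isGLB X φ ψ := by
    obtain ⟨L, e, he⟩ := X.isLGraph
    obtain ⟨a, rfl⟩ := (MPM.orderIso e he).surjective φ
    obtain ⟨b, rfl⟩ := (MPM.orderIso e he).surjective ψ
    exact ⟨_, MPM.isGLB_iff.2 (MPM.oneSet_orderIso_inf e he a b)⟩
  exists_isTop X := by
    obtain ⟨L, e, he⟩ := X.isLGraph
    exact ⟨_, MPM.isTop_iff.2 (MPM.zeroSet_orderIso_top e he)⟩
  exists_isBot X := by
    obtain ⟨L, e, he⟩ := X.isLGraph
    exact ⟨_, MPM.isBot_iff.2 (MPM.oneSet_orderIso_bot e he)⟩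
  isMPM α φ := (α.2.1.isMPE_pcomp φ.2.isMPE).isMPM
    ((isClosed_of_isPartialMorphism φ.2.1 true).preimage α.2.2)
    ((isClosed_of_isPartialMorphism φ.2.1 false).preimage α.2.2)
  isLUB α _ _ _ h := MPM.isLUB_iff.2 (congrArg (α.1 ⁻¹' ·) (MPM.isLUB_iff.1 h))
  isGLB α _ _ _ h := MPM.isGLB_iff.2 (congrArg (α.1 ⁻¹' ·) (MPM.isGLB_iff.1 h))
  isTop α _ h := MPM.isTop_iff.2 (congrArg (α.1 ⁻¹' ·) (MPM.isTop_iff.1 h))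
  isBot α _ h := MPM.isBot_iff.2 (congrArg (α.1 ⁻¹' ·) (MPM.isBot_iff.1 h))

/-! ### The adjunction -/

section Adjunction

variable {X : TopLGraph.{u}} {L : BddLat.{u}} (e : X.carrier ≃ₜ SPH L)
  (he : ∀ x y, SPH.E (e x) (e y) ↔ X.E x y)

/-- `MPM.orderIso` as an isomorphism from `L` onto the bounded lattice `Ē(X)`. -/
noncomputable def ebarOrderIso : L ≃o EbarObj ebarWellDefined X :=
  MPM.orderIso e he

/-- The isomorphism `a ↦ ē_a` from `L` onto `Ē(D̄(L))`. -/
noncomputable def evalIso (L : BddLat.{u}) : L ≅ EbarObj ebarWellDefined (dualSpace L) :=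
  BddLat.Iso.mk (ebarOrderIso (X := dualSpace L) (Homeomorph.refl (SPH L)) fun _ _ => Iff.rfl)

theorem pcomp_ebarOrderIso_symm (x : X.carrier) :
    pcomp (e x).1 (ebarOrderIso e he).symm = fun φ : MPM X.E => φ.1 x := by
  funext φ
  obtain ⟨a, rfl⟩ := (ebarOrderIso e he).surjective φ
  rw [pcomp, OrderIso.symm_apply_apply]
  rfl

theorem isSPH_pointEval (X : TopLGraph.{u}) (x : X.carrier) :
    IsSPH (L := EbarObj ebarWellDefined X) fun φ : MPM X.E => φ.1 x := by
  obtain ⟨L, e, he⟩ := X.isLGraph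
  rw [← pcomp_ebarOrderIso_symm e he x]
  exact (e x).2.pcomp ((ebarOrderIso e he).symm : BoundedLatticeHom (EbarObj ebarWellDefined X) L)

/-- The map from `X` to `D̄(Ē(X))` sending a point `x` to the evaluation `φ ↦ φ(x)` of MPM's at
`x`; it is the counit of the adjunction. -/
noncomputable def pointEval (X : TopLGraph.{u}) (x : X.carrier) :
    SPH (EbarObj ebarWellDefined X) :=
  SPH.mk _ (isSPH_pointEval X x)

theorem pointEval_eq_comap (x : X.carrier) :
    pointEval X x = SPH.comap ((ebarOrderIso e he).symm : BoundedLatticeHom _ L) (e x) :=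
  Subtype.ext (pcomp_ebarOrderIso_symm e he x).symm

theorem pointEval_rel_iff (x y : X.carrier) :
    SPH.E (pointEval X x) (pointEval X y) ↔ X.E x y := by
  obtain ⟨L, e, he⟩ := X.isLGraph
  rw [pointEval_eq_comap e he, pointEval_eq_comap e he, ← he]
  exact SPH.comap_rel_comap_iff (ebarOrderIso e he).symm.surjective

theorem pointEval_surjective (X : TopLGraph.{u}) : Function.Surjective (pointEval X) := by
  intro g
  obtain ⟨L, e, he⟩ := X.isLGraph
  let i := ebarOrderIso e he
  refine ⟨e.symm (SPH.comap (i : BoundedLatticeHom L (EbarObj ebarWellDefined X)) g), ?_⟩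
  rw [pointEval_eq_comap e he, e.apply_symm_apply]
  exact Subtype.ext (funext fun φ => congrArg g.1 (i.apply_symm_apply φ))

theorem continuous_pointEval (X : TopLGraph.{u}) : Continuous (pointEval X) := by
  refine continuous_generateFrom_iff.2 ?_
  rintro _ ⟨(φ : MPM X.E), s, rfl⟩
  exact (isClosed_of_isPartialMorphism φ.2.1 s).isOpen_compl

/-- `pointEval` as a morphism of `𝓨_𝒯`. -/
noncomputable def pointEvalHom (X : TopLGraph.{u}) : X ⟶ dualSpace (EbarObj ebarWellDefined X) :=
  ⟨pointEval X, isLGraphMorphism_of_surjective (pointEval_surjective X) pointEval_rel_iff,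
    continuous_pointEval X⟩

/-- The adjunction `D̄ ⊣ Ē` with unit `a ↦ ē_a` and counit `pointEval`. -/
noncomputable def dualAdjunction : Dbar.{u} dbarWellDefined ⊣ Ebar ebarWellDefined :=
  Adjunction.mkOfUnitCounit
    { unit :=
        { app := fun L => (evalIso L).hom
          naturality := fun _ _ _ => rfl }
      counit :=
        { app := fun X => (pointEvalHom X.unop).op
          naturality := fun _ _ _ => rfl }
      left_triangle := rfl
      right_triangle := rfl }

end Adjunction

/-! ### Canonical extensions -/

section Completion

variable {L K C D : Type u} [CompleteLattice C] [CompleteLattice D] {e : L → C}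

theorem IsFilterElement.sInf_image_setOf_le {p : C} (hp : IsFilterElement e p) :
    sInf (e '' {a | p ≤ e a}) = p := by
  obtain ⟨A, rfl⟩ := hp
  exact le_antisymm (sInf_le_sInf (Set.image_mono fun a ha => sInf_le (Set.mem_image_of_mem e ha)))
    (le_sInf (Set.forall_mem_image.2 fun _ ha => ha))

theorem IsIdealElement.sSup_image_setOf_le {q : C} (hq : IsIdealElement e q) :
    sSup (e '' {a | e a ≤ q}) = q := by
  obtain ⟨A, rfl⟩ := hq
  exact le_antisymm (sSup_le (Set.forall_mem_image.2 fun _ ha => ha))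
    (sSup_le_sSup (Set.image_mono fun a ha => le_sSup (Set.mem_image_of_mem e ha)))

theorem sigmaExt_eq_biSup (e : L → C) (d : K → D) (v : L → K) (x : C) :
    sigmaExt e d v x =
      ⨆ p ∈ {p | IsFilterElement e p ∧ p ≤ x}, sInf ((fun a => d (v a)) '' {a | p ≤ e a}) := by
  rw [← sSup_image]
  simp only [sigmaExt, Set.image, Set.mem_ofPred_eq, and_assoc, eq_comm]

theorem piExt_eq_biInf (e : L → C) (d : K → D) (v : L → K) (x : C) :
    piExt e d v x =
      ⨅ q ∈ {q | IsIdealElement e q ∧ x ≤ q}, sSup ((fun a => d (v a)) '' {a | e a ≤ q}) := by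
  rw [← sInf_image]
  simp only [piExt, Set.image, Set.mem_ofPred_eq, and_assoc, eq_comm]

end Completion

section CanonicalExtension

variable {L K C D : Type u} [Lattice L] [BoundedOrder L] [CompleteLattice C] [CompleteLattice D]
  {e : BoundedLatticeHom L C} {h k : CompleteLatticeHom C D} {x y : C}

theorem IsCanonicalExtension.eq_sigmaExt (he : IsCanonicalExtension e) {d : K → D} {v : L → K}
    (hv : ∀ a, h (e a) = d (v a)) (x : C) : h x = sigmaExt e d v x := by
  have map_filterElement {p : C} (hp : IsFilterElement e p) :
      h p = sInf ((fun a => d (v a)) '' {a | p ≤ e a}) := by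
    conv_lhs => rw [← hp.sInf_image_setOf_le, map_sInf, Set.image_image]
    simp only [hv]
  rw [sigmaExt_eq_biSup]
  refine le_antisymm ?_ (iSup₂_le fun p hp =>
    (map_filterElement hp.1).ge.trans (OrderHomClass.mono h hp.2))
  obtain ⟨S, hS, rfl⟩ := he.exists_sSup x
  rw [map_sSup]
  refine sSup_le (Set.forall_mem_image.2 fun p hp => ?_)
  exact le_iSup₂_of_le p ⟨hS p hp, le_sSup hp⟩ (map_filterElement (hS p hp)).le

theorem IsCanonicalExtension.eq_piExt (he : IsCanonicalExtension e) {d : K → D} {v : L → K}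
    (hv : ∀ a, h (e a) = d (v a)) (x : C) : h x = piExt e d v x := by
  have map_idealElement {q : C} (hq : IsIdealElement e q) :
      h q = sSup ((fun a => d (v a)) '' {a | e a ≤ q}) := by
    conv_lhs => rw [← hq.sSup_image_setOf_le, map_sSup, Set.image_image]
    simp only [hv]
  rw [piExt_eq_biInf]
  refine le_antisymm (le_iInf₂ fun q hq =>
    (OrderHomClass.mono h hq.2).trans (map_idealElement hq.1).le) ?_
  obtain ⟨S, hS, rfl⟩ := he.exists_sInf x
  rw [map_sInf]
  refine le_sInf (Set.forall_mem_image.2 fun q hq => ?_)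
  exact iInf₂_le_of_le q ⟨hS q hq, sInf_le hq⟩ (map_idealElement (hS q hq)).ge

theorem IsCanonicalExtension.hom_ext (he : IsCanonicalExtension e)
    (hk : ∀ a, h (e a) = k (e a)) (x : C) : h x = k x :=
  (he.eq_sigmaExt (d := fun a => k (e a)) (v := id) hk x).trans
    (he.eq_sigmaExt (fun _ => rfl) x).symm

theorem sInf_image_finset (e : BoundedLatticeHom L C) (s : Finset L) :
    sInf (e '' s) = e (s.inf id) := by
  rw [map_finset_inf, Finset.inf_eq_sInf_image]
  rfl

theorem sSup_image_finset (e : BoundedLatticeHom L C) (s : Finset L) :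
    sSup (e '' s) = e (s.sup id) := by
  rw [map_finset_sup, Finset.sup_eq_sSup_image]
  rfl

theorem IsCanonicalExtension.sInf_image_le_sSup_image (he : IsCanonicalExtension e)
    (d : BoundedLatticeHom L D) {A B : Set L} (h : sInf (e '' A) ≤ sSup (e '' B)) :
    sInf (d '' A) ≤ sSup (d '' B) := by
  obtain ⟨s, hsA, t, htB, hs, ht, hst⟩ := he.compact A B h
  lift s to Finset L using hs
  lift t to Finset L using ht
  rw [sInf_image_finset, sSup_image_finset] at hst
  have hle : s.inf id ≤ t.sup id := (orderEmbeddingOfInjective e he.injective).le_iff_le.1 hst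
  calc sInf (d '' A) ≤ sInf (d '' s) := sInf_le_sInf (Set.image_mono hsA)
    _ = d (s.inf id) := sInf_image_finset d s
    _ ≤ d (t.sup id) := OrderHomClass.mono d hle
    _ = sSup (d '' t) := (sSup_image_finset d t).symm
    _ ≤ sSup (d '' B) := sSup_le_sSup (Set.image_mono htB)

theorem IsCanonicalExtension.le_iff_forall_le_sSup (he : IsCanonicalExtension e) :
    x ≤ y ↔ ∀ B : Set L, y ≤ sSup (e '' B) → x ≤ sSup (e '' B) := by
  refine ⟨fun h B => h.trans, fun h => ?_⟩
  obtain ⟨S, hS, rfl⟩ := he.exists_sInf y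
  refine le_sInf fun q hq => ?_
  obtain ⟨B, rfl⟩ := hS q hq
  exact h B (sInf_le hq)

theorem IsCanonicalExtension.eq_of_forall_le_sSup_iff (he : IsCanonicalExtension e)
    (h : ∀ B : Set L, x ≤ sSup (e '' B) ↔ y ≤ sSup (e '' B)) : x = y :=
  le_antisymm (he.le_iff_forall_le_sSup.2 fun B => (h B).2)
    (he.le_iff_forall_le_sSup.2 fun B => (h B).1)

variable {d : BoundedLatticeHom L D} (he : IsCanonicalExtension e) (hd : IsCanonicalExtension d)
include he hd

theorem sigmaExt_id_le_sSup_iff {B : Set L} :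
    sigmaExt e d id x ≤ sSup (d '' B) ↔ x ≤ sSup (e '' B) := by
  rw [sigmaExt_eq_biSup, iSup₂_le_iff]
  refine ⟨fun h => ?_, fun h p hp => he.sInf_image_le_sSup_image d
    (hp.1.sInf_image_setOf_le.trans_le (hp.2.trans h))⟩
  obtain ⟨S, hS, rfl⟩ := he.exists_sSup x
  refine sSup_le fun p hp => ?_
  rw [← (hS p hp).sInf_image_setOf_le]
  exact hd.sInf_image_le_sSup_image e (h p ⟨hS p hp, le_sSup hp⟩)

theorem sigmaExt_id_sigmaExt_id (x : C) : sigmaExt d e id (sigmaExt e d id x) = x :=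
  he.eq_of_forall_le_sSup_iff fun B => by
    rw [sigmaExt_id_le_sSup_iff hd he, sigmaExt_id_le_sSup_iff he hd]

/-- The isomorphism between two canonical extensions of `L`: the `σ`-extension of the identity. -/
def canonicalOrderIso : C ≃o D where
  toFun := sigmaExt e d id
  invFun := sigmaExt d e id
  left_inv := sigmaExt_id_sigmaExt_id he hd
  right_inv := sigmaExt_id_sigmaExt_id hd he
  map_rel_iff' {x y} := by
    rw [he.le_iff_forall_le_sSup, hd.le_iff_forall_le_sSup]
    exact forall_congr' fun B => imp_congr (sigmaExt_id_le_sSup_iff he hd)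
      (sigmaExt_id_le_sSup_iff he hd)

theorem canonicalOrderIso_apply_embedding (a : L) : canonicalOrderIso he hd (e a) = d a := by
  refine hd.eq_of_forall_le_sSup_iff fun B => (sigmaExt_id_le_sSup_iff he hd).trans ?_
  rw [← sInf_singleton (a := e a), ← sInf_singleton (a := d a), ← Set.image_singleton,
    ← Set.image_singleton]
  exact ⟨he.sInf_image_le_sSup_image d, hd.sInf_image_le_sSup_image e⟩

end CanonicalExtension

/-! ### The canonical extension by evaluation maps -/

section Separation

variable {L : BddLat.{u}} {A B : Set L}

theorem isPFilter_setOf_finset_inf_le {P : Type*} [SemilatticeInf P] [OrderTop P] (A : Set P) :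
    Order.IsPFilter {a | ∃ s : Finset P, ↑s ⊆ A ∧ s.inf id ≤ a} := by
  classical
  refine isPFilter_of_inf_mem ⟨⊤, ∅, by simp⟩ (fun a b hab ⟨s, hs, hsa⟩ =>
    ⟨s, hs, hsa.trans hab⟩) ?_
  rintro a b ⟨s, hs, hsa⟩ ⟨t, ht, htb⟩
  exact ⟨s ∪ t, by simp [hs, ht], by rw [Finset.inf_union]; exact inf_le_inf hsa htb⟩

theorem isIdeal_setOf_le_finset_sup {P : Type*} [SemilatticeSup P] [OrderBot P] (B : Set P) :
    Order.IsIdeal {b | ∃ t : Finset P, ↑t ⊆ B ∧ b ≤ t.sup id} :=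
  isPFilter_setOf_finset_inf_le (P := Pᵒᵈ) B

theorem SPH.exists_subset_oneSet_subset_zeroSet
    (h : ∀ s t : Finset L, ↑s ⊆ A → ↑t ⊆ B → ¬ s.inf id ≤ t.sup id) :
    ∃ f : SPH L, A ⊆ oneSet f.1 ∧ B ⊆ zeroSet f.1 := by
  obtain ⟨f, hf1, hf0⟩ := SPH.exists_oneSet_eq_zeroSet_eq (isPFilter_setOf_finset_inf_le A)
    (isIdeal_setOf_le_finset_sup B) <| Set.disjoint_left.2 <| by
      rintro a ⟨s, hs, hsa⟩ ⟨t, ht, hat⟩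
      exact h s t hs ht (hsa.trans hat)
  exact ⟨f, fun a ha => hf1.ge ⟨{a}, by simpa using ha, by simp⟩,
    fun b hb => hf0.ge ⟨{b}, by simpa using hb, by simp⟩⟩

end Separation

/-- The composite `Ḡ ∘ ♭ ∘ D̄`. -/
noncomputable abbrev canonicalFunctor : BddLat.{u} ⥤ CompleteLat.{u} :=
  Dbar dbarWellDefined ⋙ flat.op ⋙ Gbar gbarWellDefined

section Embedding

noncomputable instance (L : BddLat.{u}) : CompleteLattice (MPE (SPH.E (L := L))) :=
  gbarWellDefined.completeLattice (flat.obj (dualSpace L))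

/-- The embedding `a ↦ ē_a` of `L` into the complete lattice `Ḡ(♭(D̄(L)))`. -/
noncomputable def evalEmbedding (L : BddLat.{u}) :
    BoundedLatticeHom L (canonicalFunctor.obj L) :=
  { toFun := fun a => (MPE.mk (evalMap a) (isMPE_evalMap a) : MPE (SPH.E (L := L)))
    map_sup' := fun a b => (MPE.isLUB_iff.2 (by
      rw [Set.biInter_pair]
      exact zeroSet_evalMap_sup a b)).unique isLUB_pair
    map_inf' := fun a b => (MPE.isGLB_iff.2 (by
      rw [Set.biInter_pair]
      exact oneSet_evalMap_inf a b)).unique isGLB_pair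
    map_top' := top_unique <| MPE.le_iff_zeroSet_subset.2 <|
      (zeroSet_evalMap_top L).trans_subset (Set.empty_subset _)
    map_bot' := bot_unique ((oneSet_evalMap_bot L).trans_subset (Set.empty_subset _)) }

variable {L : BddLat.{u}} {A B : Set L} {f : SPH L}

theorem mem_oneSet_sInf_image_evalEmbedding :
    f ∈ oneSet (sInf (evalEmbedding L '' A) : MPE (SPH.E (L := L))).1 ↔ A ⊆ oneSet f.1 := by
  have h := MPE.isGLB_iff.1 (isGLB_sInf (evalEmbedding L '' A))
  exact (Set.ext_iff.1 h f).trans (Set.mem_iInter₂.trans Set.forall_mem_image)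

theorem mem_zeroSet_sSup_image_evalEmbedding :
    f ∈ zeroSet (sSup (evalEmbedding L '' B) : MPE (SPH.E (L := L))).1 ↔ B ⊆ zeroSet f.1 := by
  have h := MPE.isLUB_iff.1 (isLUB_sSup (evalEmbedding L '' B))
  exact (Set.ext_iff.1 h f).trans (Set.mem_iInter₂.trans Set.forall_mem_image)

theorem evalEmbedding_injective : Function.Injective (evalEmbedding L) := fun _ _ h =>
  le_antisymm (oneSet_evalMap_subset_iff.1 (congrArg (fun φ : MPE SPH.E => oneSet φ.1) h).le)
    (oneSet_evalMap_subset_iff.1 (congrArg (fun φ : MPE SPH.E => oneSet φ.1) h).ge)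

theorem sSup_sInf_image_evalEmbedding (φ : MPE (SPH.E (L := L))) :
    sSup ((fun f => sInf (evalEmbedding L '' oneSet f.1)) '' oneSet φ.1) =
      (φ : canonicalFunctor.obj L) := by
  refine le_antisymm (sSup_le (Set.forall_mem_image.2 fun f hf g hg => ?_)) fun f hf => ?_
  · exact φ.2.oneSet_upward (SPH.le₁_iff.2 (mem_oneSet_sInf_image_evalEmbedding.1 hg)) hf
  · exact le_sSup (Set.mem_image_of_mem (fun f : SPH L => sInf (evalEmbedding L '' oneSet f.1)) hf)
      (mem_oneSet_sInf_image_evalEmbedding.2 subset_rfl)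

theorem sInf_sSup_image_evalEmbedding (φ : MPE (SPH.E (L := L))) :
    sInf ((fun f => sSup (evalEmbedding L '' zeroSet f.1)) '' zeroSet φ.1) =
      (φ : canonicalFunctor.obj L) := by
  refine le_antisymm (MPE.le_iff_zeroSet_subset.2 fun f hf => ?_)
    (le_sInf (Set.forall_mem_image.2 fun f hf => MPE.le_iff_zeroSet_subset.2 fun g hg => ?_))
  · exact MPE.le_iff_zeroSet_subset.1 (sInf_le (Set.mem_image_of_mem
      (fun f : SPH L => sSup (evalEmbedding L '' zeroSet f.1)) hf))
      (mem_zeroSet_sSup_image_evalEmbedding.2 subset_rfl)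
  · exact φ.2.zeroSet_upward (SPH.le₂_iff.2 (mem_zeroSet_sSup_image_evalEmbedding.1 hg)) hf

theorem exists_finset_inf_le_sup
    (h : sInf (evalEmbedding L '' A) ≤ sSup (evalEmbedding L '' B)) :
    ∃ s t : Finset L, ↑s ⊆ A ∧ ↑t ⊆ B ∧ s.inf id ≤ t.sup id := by
  by_contra! hne
  obtain ⟨f, hf1, hf0⟩ := SPH.exists_subset_oneSet_subset_zeroSet hne
  exact Set.disjoint_left.1 (disjoint_oneSet_zeroSet _)
    (h (mem_oneSet_sInf_image_evalEmbedding.2 hf1)) (mem_zeroSet_sSup_image_evalEmbedding.2 hf0)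

theorem isCanonicalExtension_evalEmbedding : IsCanonicalExtension (evalEmbedding L) where
  injective := evalEmbedding_injective
  exists_sSup φ := ⟨_, Set.forall_mem_image.2 fun _ _ => ⟨_, rfl⟩,
    (sSup_sInf_image_evalEmbedding φ).symm⟩
  exists_sInf φ := ⟨_, Set.forall_mem_image.2 fun _ _ => ⟨_, rfl⟩,
    (sInf_sSup_image_evalEmbedding φ).symm⟩
  compact A B h := by
    obtain ⟨s, t, hs, ht, hst⟩ := exists_finset_inf_le_sup h
    refine ⟨s, hs, t, ht, s.finite_toSet, t.finite_toSet, ?_⟩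
    rw [sInf_image_finset, sSup_image_finset]
    exact OrderHomClass.mono (evalEmbedding L) hst

end Embedding

/-! ### Canonical extension functors -/

section Functor

variable {Δ Δ' : BddLat.{u} ⥤ CompleteLat.{u}}
  {η : 𝟭 BddLat.{u} ⟶ Δ ⋙ forget₂ CompleteLat.{u} BddLat.{u}}
  {η' : 𝟭 BddLat.{u} ⟶ Δ' ⋙ forget₂ CompleteLat.{u} BddLat.{u}}

theorem map_app_apply (η : 𝟭 BddLat.{u} ⟶ Δ ⋙ forget₂ CompleteLat.{u} BddLat.{u})
    {L K : BddLat.{u}} (v : L ⟶ K) (a : L) : Δ.map v ((η.app L).hom a) = (η.app K).hom (v a) :=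
  (congrArg (fun g => BddLat.Hom.hom g a) (η.naturality v)).symm

/-- The isomorphism between two canonical extension functors that commutes with the embeddings. -/
noncomputable def canonicalNatIso (h : IsCanonicalExtensionFunctor Δ η)
    (h' : IsCanonicalExtensionFunctor Δ' η') : Δ ≅ Δ' :=
  NatIso.ofComponents (fun L => CompleteLat.Iso.mk (canonicalOrderIso (h L) (h' L))) <| by
    intro L K v
    ext x
    refine (h L).hom_ext (fun a => ?_) x
    calc canonicalOrderIso (h K) (h' K) (Δ.map v ((η.app L).hom a))
        = canonicalOrderIso (h K) (h' K) ((η.app K).hom (v a)) := by rw [map_app_apply]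
      _ = (η'.app K).hom (v a) := canonicalOrderIso_apply_embedding (h K) (h' K) (v a)
      _ = Δ'.map v ((η'.app L).hom a) := (map_app_apply η' v a).symm
      _ = Δ'.map v (canonicalOrderIso (h L) (h' L) ((η.app L).hom a)) := by
        rw [canonicalOrderIso_apply_embedding]

theorem IsCanonicalExtensionFunctor.existsUnique_iso (h : IsCanonicalExtensionFunctor Δ η)
    (h' : IsCanonicalExtensionFunctor Δ' η') :
    ∃! i : Δ ≅ Δ', ∀ (L : BddLat.{u}) (a : L),
      i.hom.app L ((η.app L).hom a) = (η'.app L).hom a := by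
  have hcomm (L : BddLat.{u}) (a : L) :
      (canonicalNatIso h h').hom.app L ((η.app L).hom a) = (η'.app L).hom a :=
    canonicalOrderIso_apply_embedding (h L) (h' L) a
  refine ⟨canonicalNatIso h h', hcomm, fun j hj => ?_⟩
  ext L x
  exact (h L).hom_ext (fun a => (hj L a).trans (hcomm L a).symm) x

end Functor

/-- The embeddings `a ↦ ē_a` as a natural transformation. -/
noncomputable def evalNatTrans :
    𝟭 BddLat.{u} ⟶ canonicalFunctor ⋙ forget₂ CompleteLat.{u} BddLat.{u} where
  app L := BddLat.ofHom (evalEmbedding L)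
  naturality _ _ _ := rfl

theorem isCanonicalExtensionFunctor_evalNatTrans :
    IsCanonicalExtensionFunctor canonicalFunctor.{u} evalNatTrans :=
  fun _ => isCanonicalExtension_evalEmbedding

end LatDual

open CategoryTheory Opposite LatDual in
theorem mainTheorem2 :
    -- (i) `D̄` and `Ḡ` are well-defined functors
    ∃ (hD : DbarWellDefined.{u}) (hG : GbarWellDefined.{u}),
    -- (ii) `D̄` has the right adjoint `Ē`; the unit consists of evaluation maps and is invertible
    (∃ (hE : EbarWellDefined.{u}) (adj : Dbar hD ⊣ Ebar hE),
      ∀ L : BddLat.{u},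
        (∀ a : L, ((adj.unit.app L).hom a : MPM (dualSpace L).E).1 = evalMap a) ∧
        IsIso (adj.unit.app L)) ∧
    -- (iii) `Ḡ ∘ ♭ ∘ D̄`, with the evaluation maps as embeddings, is the canonical extension functor
    (∃ ε : 𝟭 BddLat.{u} ⟶
        (Dbar hD ⋙ flat.op ⋙ Gbar hG) ⋙ forget₂ CompleteLat.{u} BddLat.{u},
      (∀ (L : BddLat.{u}) (a : L),
        ((ε.app L).hom a : MPE (flat.obj (dualSpace L)).E).1 = evalMap a) ∧
      IsCanonicalExtensionFunctor (Dbar hD ⋙ flat.op ⋙ Gbar hG) ε ∧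
      (∀ (L K : BddLat.{u}) (f : L ⟶ K) (x : (Dbar hD ⋙ flat.op ⋙ Gbar hG).obj L),
        (Dbar hD ⋙ flat.op ⋙ Gbar hG).map f x =
            sigmaExt (C := (Dbar hD ⋙ flat.op ⋙ Gbar hG).obj L)
              (D := (Dbar hD ⋙ flat.op ⋙ Gbar hG).obj K)
              (ε.app L).hom (ε.app K).hom (fun a : L => f a) x ∧
        (Dbar hD ⋙ flat.op ⋙ Gbar hG).map f x =
            piExt (C := (Dbar hD ⋙ flat.op ⋙ Gbar hG).obj L)
              (D := (Dbar hD ⋙ flat.op ⋙ Gbar hG).obj K)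
              (ε.app L).hom (ε.app K).hom (fun a : L => f a) x) ∧
      ∀ (Δ : BddLat.{u} ⥤ CompleteLat.{u})
        (η : 𝟭 BddLat.{u} ⟶ Δ ⋙ forget₂ CompleteLat.{u} BddLat.{u}),
        IsCanonicalExtensionFunctor Δ η →
        ∃! i : Dbar hD ⋙ flat.op ⋙ Gbar hG ≅ Δ,
          ∀ (L : BddLat.{u}) (a : L), i.hom.app L ((ε.app L).hom a) = (η.app L).hom a) := by
  refine ⟨dbarWellDefined, gbarWellDefined,
    ⟨ebarWellDefined, dualAdjunction, fun L =>
      ⟨fun _ => rfl, inferInstanceAs (IsIso (evalIso L).hom)⟩⟩,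
    evalNatTrans, fun _ _ => rfl, isCanonicalExtensionFunctor_evalNatTrans, fun L K v x => ?_,
    fun Δ η h => isCanonicalExtensionFunctor_evalNatTrans.existsUnique_iso h⟩
  have hv (a : L) : canonicalFunctor.map v (evalEmbedding L a) = evalEmbedding K (v a) := rfl
  exact ⟨isCanonicalExtension_evalEmbedding.eq_sigmaExt hv x,
    isCanonicalExtension_evalEmbedding.eq_piExt hv x⟩
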